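/- There exist universal constants $c>0$, $C>0$ and $d_0\in\mathbb N$ such that the following holds for all integers $d\ge d_0$ and $n\ge 1$, all $\xi\in(0,1/e)$ and all $\alpha>0$ with $$c\,\sqrt{\frac{\log d}{n}}\;\le\;\alpha\;\le\;\min\left\{c\cdot\frac{d^{0.49}}{n\sqrt{\log(1/\xi)}},\ \frac18\right\}.$$ Let $\mathcal Z=\{\pm1\}^d$ and let $\hat\mu$ be any (possibly randomized) estimator that maps a sample $(Z_1,\dots,Z_n)\in\mathcal Z^n$ to a random vector in $\mathbb R^d$ and that satisfies, for every probability distribution $\mathcal D$ on $\mathcal Z$ and i.i.d. samples $Z_1,\dots,Z_n\sim\mathcal D$, $$\mathbb E\,\bigl\|\hat\mu(Z_1,\dots,Z_n)-\mathbb E_{Z\sim\mathcal D}[Z]\bigr\|_\infty\le \frac{\alpha}{2}.$$ Then $\hat\mu$ is $(\xi,m)$-traceable for some integer $m\ge C\,\dfrac{\log d}{\alpha^2}$. Here $\hat\mu$ is called $(\xi,m)$-traceable if there exist a score function $\varphi:\mathbb R^d\times\mathcal Z\to\mathbb R$, a probability distribution $\mathcal D$ on $\mathcal Z$ and a threshold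 $\lambda\in\mathbb R$ such that, for $(Z_0,Z_1,\dots,Z_n)\sim\mathcal D^{\otimes(n+1)}$ and $\hat\mu=\hat\mu(Z_1,\dots,Z_n)$ (with internal randomness independent of $Z_0$): (i) (soundness) $\Pr\bigl(\varphi(\hat\mu,Z_0)\ge\lambda\bigr)\le\xi$, and (ii) (recall) $\mathbb E\,\bigl|\{i\in\{1,\dots,n\}:\varphi(\hat\mu,Z_i)\ge\lambda\}\bigr|\ge m$. -/

import Mathlib

open MeasureTheory ProbabilityTheory

open scoped ENNReal

noncomputable section

/-- The joint law of `((Z₁, …, Zₙ), θ)` when `Z₁, …, Zₙ` are i.i.d. with law `D` and, given the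
sample, `θ` is drawn from `A (Z₁, …, Zₙ)`. A (randomized) learning algorithm is a Markov kernel
from samples of size `n` to the output space. -/
def trainLaw {Z Θ : Type*} [MeasurableSpace Z] [MeasurableSpace Θ] {n : ℕ}
    (A : Kernel (Fin n → Z) Θ) (D : Measure Z) : Measure ((Fin n → Z) × Θ) :=
  (Measure.pi fun _ : Fin n => D) ⊗ₘ A

/-- `(ξ, m)`-traceability of the algorithm `A`: there are a tracer, that is, a (measurable) score
`φ` and a data distribution `D`, and a threshold `t` such that, with `Z₁, …, Zₙ` i.i.d. from `D`,
`θ` drawn from `A (Z₁, …, Zₙ)` and `Z₀` a fresh independent sample from `D`,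
the probability of `φ θ Z₀ ≥ t` is at most `ξ` (soundness), and
the expected number of `i` with `φ θ Zᵢ ≥ t` is at least `m` (recall). -/
def IsTraceable {Z Θ : Type*} [MeasurableSpace Z] [MeasurableSpace Θ] {n : ℕ}
    (A : Kernel (Fin n → Z) Θ) (ξ : ℝ) (m : ℕ) : Prop :=
  ∃ φ : Θ → Z → ℝ, Measurable (Function.uncurry φ) ∧
    ∃ D : Measure Z, IsProbabilityMeasure D ∧
      ∃ t : ℝ,
        ((trainLaw A D).prod D) {ω | t ≤ φ ω.1.2 ω.2} ≤ ENNReal.ofReal ξ ∧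
        (m : ℝ≥0∞) ≤ ∫⁻ ω, (({i : Fin n | t ≤ φ ω.2 (ω.1 i)} : Set (Fin n)).ncard : ℝ≥0∞)
          ∂(trainLaw A D)

/-- The discrete cube `{±1}^d`. -/
def signCube (d : ℕ) : Set (Fin d → ℝ) := {z | ∀ k, z k = 1 ∨ z k = -1}

/-- The mean vector of a distribution on `{±1}^d`. -/
def cubeMean {d : ℕ} (D : Measure (signCube d)) : Fin d → ℝ :=
  fun k => ∫ z, (z : Fin d → ℝ) k ∂D

/-- `A` estimates the mean of every distribution on `{±1}^d` from `n` i.i.d. samples with expected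
`ℓ_∞` error at most `r`. The norm on `Fin d → ℝ` is the sup norm. -/
def IsMeanEstimator {d n : ℕ} (A : Kernel (Fin n → signCube d) (Fin d → ℝ)) (r : ℝ) : Prop :=
  ∀ D : Measure (signCube d), IsProbabilityMeasure D →
    ∫⁻ ω, ‖ω.2 - cubeMean D‖ₑ ∂(trainLaw A D) ≤ ENNReal.ofReal r

end

noncomputable section

/-! ### Product laws on the cube -/

/-! The tracer scores a point `u` by `∑ k ∈ H θ, (u k - p k) / (1 - p k ^ 2)`, where `H θ` consists
of `h ≈ d^0.996 / 16` coordinates at which the output `θ` is at least `2α`, or is empty if there are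
too few. For a fresh point this is a sum of independent bounded centered terms, so a threshold `T`
of order `√(h log (1/ξ))` gives soundness. Recall comes from comparing two bounds on the expected
total score of the sample.

Lower bound (`exists_totalScore_ge_of_isMeanEstimator`). Differentiating the expectation of a
statistic `F` in `p k` multiplies `F` by the sum over the sample of the centered `k`-th coordinates.
Draw the means from Laplace densities `∝ exp (-lam |x|)` truncated to `[-5α, 5α]`. Integration by
parts turns the average derivative into `lam` times the average of `sign (p k) * F`, up to a
boundary term `lam * exp (-5α lam)`. Accuracy makes the selected coordinates have positive mean, so
the signs add up to a constant multiple of `h`, and some `p` has total score at least `lam * h / 8`.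
Here `lam` is of order `log d / α`: small enough that polynomially many coordinates, more than `h`,
exceed `4α` with good probability, large enough that the `d` boundary terms are absorbed.

Upper bound (`totalScore_le`). Untraced points contribute at most `n * T`, which is negligible
because `√h` exceeds `d^0.49` by a power of `d`. A union bound over all sets of points and all
`h`-sets of coordinates shows that `N` traced points contribute at most a multiple of `√(log d) *
(√h N + h √N)`, outside an event of probability at most `9 / d²`. If the expected `N` were at most a
small multiple of `log d / α²`, this would be a small multiple of `h log d / α`, below the lower
bound (`score_bounds_separated`). -/

theorem mem_signCube_iff {d : ℕ} (u : Fin d → ℝ) :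
    u ∈ Fintype.piFinset (fun _ : Fin d => ({1, -1} : Finset ℝ)) ↔ u ∈ signCube d := by
  simp [Fintype.mem_piFinset, signCube]

instance signCubeFintype (d : ℕ) : Fintype (signCube d) :=
  Fintype.subtype _ mem_signCube_iff

theorem sum_signCube_prod {d : ℕ} (f : Fin d → ℝ → ℝ) :
    ∑ u : signCube d, ∏ k, f k (u.1 k) = ∏ k, (f k 1 + f k (-1)) := by
  have h := Finset.prod_univ_sum (fun _ : Fin d => ({1, -1} : Finset ℝ)) f
  have h1 : ∀ k, ∑ j ∈ ({1, -1} : Finset ℝ), f k j = f k 1 + f k (-1) := fun k => by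
    rw [Finset.sum_pair (by norm_num)]
  simp only [h1] at h
  rw [h, Finset.sum_subtype _ mem_signCube_iff]

theorem signCube_eq_or {d : ℕ} (u : signCube d) (k : Fin d) : u.1 k = 1 ∨ u.1 k = -1 := u.2 k

/-- The probability of the point `u` under the product law on `{±1}^d` with mean `p`. -/
def cubeWeight {d : ℕ} (p u : Fin d → ℝ) : ℝ := ∏ k, (1 + u k * p k) / 2

/-- The probability of the sample `z` under the i.i.d. law of samples. -/
def sampleWeight {d n : ℕ} (p : Fin d → ℝ) (z : Fin n → signCube d) : ℝ :=
  ∏ i, cubeWeight p (z i).1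

/-- The normalized centered `k`-th coordinate. -/
def centered {d : ℕ} (p u : Fin d → ℝ) (k : Fin d) : ℝ := (u k - p k) / (1 - p k ^ 2)

theorem cubeFactor_nonneg {d : ℕ} {p : Fin d → ℝ} (hp : ∀ k, |p k| ≤ 5 / 8) (u : signCube d)
    (k : Fin d) : 0 ≤ (1 + u.1 k * p k) / 2 := by
  have := abs_le.1 (hp k)
  rcases signCube_eq_or u k with h | h <;> rw [h] <;> linarith

theorem cubeWeight_nonneg {d : ℕ} {p : Fin d → ℝ} (hp : ∀ k, |p k| ≤ 5 / 8) (u : signCube d) :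
    0 ≤ cubeWeight p u.1 :=
  Finset.prod_nonneg fun k _ => cubeFactor_nonneg hp u k

theorem sampleWeight_nonneg {d n : ℕ} {p : Fin d → ℝ} (hp : ∀ k, |p k| ≤ 5 / 8)
    (z : Fin n → signCube d) : 0 ≤ sampleWeight p z :=
  Finset.prod_nonneg fun i _ => cubeWeight_nonneg hp (z i)

theorem sum_cubeWeight {d : ℕ} (p : Fin d → ℝ) : ∑ u : signCube d, cubeWeight p u.1 = 1 := by
  have h := sum_signCube_prod (fun k x => (1 + x * p k) / 2)
  simp only [cubeWeight]
  rw [h]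
  exact Finset.prod_eq_one fun k _ => by ring

theorem sum_sample_prod {d n : ℕ} (g : Fin n → signCube d → ℝ) :
    ∑ z : Fin n → signCube d, ∏ i, g i (z i) = ∏ i, ∑ u, g i u := by
  rw [Finset.prod_univ_sum, Fintype.piFinset_univ]

theorem sum_sampleWeight {d : ℕ} (n : ℕ) (p : Fin d → ℝ) :
    ∑ z : Fin n → signCube d, sampleWeight p z = 1 := by
  simp only [sampleWeight]
  rw [sum_sample_prod (fun _ u => cubeWeight p u.1)]
  simp [sum_cubeWeight]

/-! ### Exponential moments of the centered coordinates. -/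

theorem abs_centered_le {d : ℕ} {p : Fin d → ℝ} (hp : ∀ k, |p k| ≤ 5 / 8) (u : signCube d)
    (k : Fin d) : |centered p u.1 k| ≤ 4 := by
  have h := abs_le.1 (hp k)
  have h1 : 0 < 1 - p k ^ 2 := by nlinarith
  rw [centered, abs_div, abs_of_pos h1, div_le_iff₀ h1, abs_le]
  rcases signCube_eq_or u k with h | h <;> rw [h] <;> constructor <;> nlinarith

/-- The chord of `exp` over `[-s b, s b]` lies above the graph. It is affine in `y`, so only its
constant term survives averaging over a mean-zero `y`. -/
theorem exp_le_of_abs_le {y b : ℝ} (hb : 0 < b) (hy : |y| ≤ b) (s : ℝ) :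
    Real.exp (s * y) ≤ Real.cosh (s * b) + y * (Real.sinh (s * b) / b) := by
  have h := abs_le.1 hy
  have hc := convexOn_exp.2 (Set.mem_univ (s * b)) (Set.mem_univ (-(s * b)))
    (show 0 ≤ (b + y) / (2 * b) by apply div_nonneg <;> linarith)
    (show 0 ≤ (b - y) / (2 * b) by apply div_nonneg <;> linarith) (by field_simp; ring)
  simp only [smul_eq_mul] at hc
  have e1 : (b + y) / (2 * b) * (s * b) + (b - y) / (2 * b) * (-(s * b)) = s * y := by
    field_simp; ring
  rw [e1] at hc
  refine hc.trans (le_of_eq ?_)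
  rw [Real.cosh_eq, Real.sinh_eq]
  field_simp; ring

/-- The two-point variable has mean zero and is bounded by `4`, so the chord bound leaves `cosh (4
s) ≤ exp (8 s ^ 2)`. -/
theorem mgf_centered_le {x : ℝ} (hx : |x| ≤ 5 / 8) (s : ℝ) :
    (1 + 1 * x) / 2 * Real.exp (s * ((1 - x) / (1 - x ^ 2))) +
      (1 + -1 * x) / 2 * Real.exp (s * ((-1 - x) / (1 - x ^ 2))) ≤ Real.exp (8 * s ^ 2) := by
  have hx' := abs_le.1 hx
  have h1 : 0 < 1 - x ^ 2 := by nlinarith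
  have a1 : |(1 - x) / (1 - x ^ 2)| ≤ 4 := by
    rw [abs_div, abs_of_pos h1, div_le_iff₀ h1, abs_le]; constructor <;> nlinarith
  have a2 : |(-1 - x) / (1 - x ^ 2)| ≤ 4 := by
    rw [abs_div, abs_of_pos h1, div_le_iff₀ h1, abs_le]; constructor <;> nlinarith
  have b1 := mul_le_mul_of_nonneg_left (exp_le_of_abs_le (by norm_num) a1 s)
    (show 0 ≤ (1 + 1 * x) / 2 by linarith)
  have b2 := mul_le_mul_of_nonneg_left (exp_le_of_abs_le (by norm_num) a2 s)
    (show 0 ≤ (1 + -1 * x) / 2 by linarith)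
  have hc := Real.cosh_le_exp_half_sq (s * 4)
  have e : (s * 4) ^ 2 / 2 = 8 * s ^ 2 := by ring
  rw [e] at hc
  refine (add_le_add b1 b2).trans (le_trans (le_of_eq ?_) hc)
  field_simp; ring

theorem mgf_cube_le {d : ℕ} {p : Fin d → ℝ} (hp : ∀ k, |p k| ≤ 5 / 8) (H : Finset (Fin d))
    (s : ℝ) : ∑ u : signCube d, cubeWeight p u.1 * Real.exp (s * ∑ k ∈ H, centered p u.1 k) ≤
      Real.exp (8 * s ^ 2 * H.card) := by
  have h := sum_signCube_prod (fun k x => (1 + x * p k) / 2 *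
    if k ∈ H then Real.exp (s * ((x - p k) / (1 - p k ^ 2))) else 1)
  have e1 : ∀ u : signCube d, cubeWeight p u.1 * Real.exp (s * ∑ k ∈ H, centered p u.1 k) =
      ∏ k, ((1 + u.1 k * p k) / 2 *
        if k ∈ H then Real.exp (s * ((u.1 k - p k) / (1 - p k ^ 2))) else 1) := fun u => by
    rw [Finset.prod_mul_distrib, cubeWeight, Finset.mul_sum, Real.exp_sum, Finset.prod_ite_mem,
      Finset.univ_inter]
    rfl
  rw [Finset.sum_congr rfl fun u _ => e1 u, h]
  have e2 : Real.exp (8 * s ^ 2 * H.card) =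
      ∏ k : Fin d, if k ∈ H then Real.exp (8 * s ^ 2) else 1 := by
    rw [Finset.prod_ite_mem, Finset.univ_inter, Finset.prod_const, ← Real.exp_nat_mul, mul_comm]
  rw [e2]
  refine Finset.prod_le_prod (fun k _ => ?_) fun k _ => ?_
  · have := abs_le.1 (hp k)
    have t1 : 0 ≤ (1 + 1 * p k) / 2 := by linarith
    have t2 : 0 ≤ (1 + -1 * p k) / 2 := by linarith
    refine add_nonneg (mul_nonneg t1 ?_) (mul_nonneg t2 ?_) <;> split_ifs <;> positivity
  · by_cases hk : k ∈ H
    · simpa [hk] using mgf_centered_le (hp k) s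
    · simp only [hk, if_false]; linarith

theorem mgf_sample_le {d n : ℕ} {p : Fin d → ℝ} (hp : ∀ k, |p k| ≤ 5 / 8) (I : Finset (Fin n))
    (H : Finset (Fin d)) (s : ℝ) :
    ∑ z : Fin n → signCube d,
      sampleWeight p z * Real.exp (s * ∑ i ∈ I, ∑ k ∈ H, centered p (z i).1 k) ≤
      Real.exp (8 * s ^ 2 * (I.card * H.card)) := by
  have h := sum_sample_prod (n := n) (fun i (u : signCube d) => cubeWeight p u.1 *
    if i ∈ I then Real.exp (s * ∑ k ∈ H, centered p u.1 k) else 1)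
  have e1 : ∀ z : Fin n → signCube d,
      sampleWeight p z * Real.exp (s * ∑ i ∈ I, ∑ k ∈ H, centered p (z i).1 k) =
      ∏ i, (cubeWeight p (z i).1 *
        if i ∈ I then Real.exp (s * ∑ k ∈ H, centered p (z i).1 k) else 1) := fun z => by
    rw [Finset.prod_mul_distrib, sampleWeight, Finset.mul_sum, Real.exp_sum,
      Finset.prod_ite_mem, Finset.univ_inter]
  rw [Finset.sum_congr rfl fun u _ => e1 u, h]
  have e2 : Real.exp (8 * s ^ 2 * (I.card * H.card)) =
      ∏ i : Fin n, if i ∈ I then Real.exp (8 * s ^ 2 * H.card) else 1 := by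
    rw [Finset.prod_ite_mem, Finset.univ_inter, Finset.prod_const, ← Real.exp_nat_mul]
    congr 1; ring
  rw [e2]
  refine Finset.prod_le_prod (fun i _ => Finset.sum_nonneg fun u _ =>
    mul_nonneg (cubeWeight_nonneg hp u) (by split_ifs <;> positivity)) fun i _ => ?_
  by_cases hi : i ∈ I
  · simpa [hi] using mgf_cube_le hp H s
  · simp [hi, sum_cubeWeight]

/-- Chernoff's bound for a finite weighted sum. -/
theorem chernoff_sum {Ω : Type*} [Fintype Ω] {w X : Ω → ℝ} (hw : ∀ z, 0 ≤ w z) {v t : ℝ}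
    (hv : 0 < v) (ht : 0 ≤ t)
    (hm : ∀ s : ℝ, ∑ z, w z * Real.exp (s * X z) ≤ Real.exp (8 * s ^ 2 * v)) :
    ∑ z with t ≤ X z, w z ≤ Real.exp (-(t ^ 2 / (32 * v))) := by
  -- This is the minimizer of `8 * s ^ 2 * v - s * t`.
  set s := t / (16 * v) with hs
  have hs0 : 0 ≤ s := by positivity
  have h1 : ∑ z with t ≤ X z, w z ≤
      Real.exp (-(s * t)) * ∑ z, w z * Real.exp (s * X z) := by
    rw [Finset.mul_sum]
    refine le_trans (Finset.sum_le_sum fun z hz => ?_) (Finset.sum_le_sum_of_subset_of_nonneg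
      (Finset.filter_subset _ _) fun z _ _ => ?_)
    · have hz' := (Finset.mem_filter.1 hz).2
      have : 1 ≤ Real.exp (-(s * t)) * Real.exp (s * X z) := by
        rw [← Real.exp_add]
        exact Real.one_le_exp (by nlinarith)
      calc w z = w z * 1 := (mul_one _).symm
        _ ≤ w z * (Real.exp (-(s * t)) * Real.exp (s * X z)) :=
          mul_le_mul_of_nonneg_left this (hw z)
        _ = _ := by ring
    · exact mul_nonneg (Real.exp_pos _).le (mul_nonneg (hw z) (Real.exp_pos _).le)
  refine h1.trans ((mul_le_mul_of_nonneg_left (hm s) (Real.exp_pos _).le).trans (le_of_eq ?_))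
  rw [← Real.exp_add]
  congr 1
  rw [hs]
  field_simp
  ring

/-- The product law on the cube with mean `p`. -/
def cubeLaw {d : ℕ} (p : Fin d → ℝ) : Measure (signCube d) :=
  ∑ u : signCube d, ENNReal.ofReal (cubeWeight p u.1) • Measure.dirac u

theorem cubeLaw_apply {d : ℕ} (p : Fin d → ℝ) (s : Set (signCube d)) [DecidablePred (· ∈ s)] :
    cubeLaw p s = ∑ u with u ∈ s, ENNReal.ofReal (cubeWeight p u.1) := by
  have hs : MeasurableSet s := s.toFinite.measurableSet
  simp only [cubeLaw, Measure.coe_finsetSum, Finset.sum_apply, Measure.smul_apply,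
    Measure.dirac_apply' _ hs, smul_eq_mul, Finset.sum_filter]
  refine Finset.sum_congr rfl fun u _ => ?_
  by_cases h : u ∈ s <;> simp [h]

theorem cubeLaw_singleton {d : ℕ} (p : Fin d → ℝ) (u : signCube d) :
    cubeLaw p {u} = ENNReal.ofReal (cubeWeight p u.1) := by
  classical
  rw [cubeLaw_apply]
  simp [Finset.filter_eq']

theorem isProbabilityMeasure_cubeLaw {d : ℕ} {p : Fin d → ℝ} (hp : ∀ k, |p k| ≤ 5 / 8) :
    IsProbabilityMeasure (cubeLaw p) := by
  classical
  constructor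
  rw [cubeLaw_apply]
  simp only [Set.mem_univ, Finset.filter_true]
  rw [← ENNReal.ofReal_sum_of_nonneg fun u _ => cubeWeight_nonneg hp u, sum_cubeWeight,
    ENNReal.ofReal_one]

theorem cubeMean_cubeLaw {d : ℕ} {p : Fin d → ℝ} (hp : ∀ k, |p k| ≤ 5 / 8) :
    cubeMean (cubeLaw p) = p := by
  classical
  have := isProbabilityMeasure_cubeLaw hp
  ext k
  rw [cubeMean, integral_fintype Integrable.of_finite]
  have e : ∀ u : signCube d, (cubeLaw p).real {u} • u.1 k =
      ∏ j, ((1 + u.1 j * p j) / 2 * if j = k then u.1 j else 1) := fun u => by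
    rw [Measure.real, cubeLaw_singleton, ENNReal.toReal_ofReal (cubeWeight_nonneg hp u),
      Finset.prod_mul_distrib, Finset.prod_ite_eq' Finset.univ k]
    simp [cubeWeight]
  rw [Finset.sum_congr rfl fun u _ => e u,
    sum_signCube_prod (fun j x => (1 + x * p j) / 2 * if j = k then x else 1)]
  have e2 : ∀ j, ((1 + 1 * p j) / 2 * (if j = k then (1 : ℝ) else 1) +
      (1 + -1 * p j) / 2 * if j = k then (-1 : ℝ) else 1) = if j = k then p j else 1 := fun j => by
    split_ifs <;> ring
  rw [Finset.prod_congr rfl fun j _ => e2 j]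
  simp

theorem pi_cubeLaw_singleton {d n : ℕ} {p : Fin d → ℝ} (hp : ∀ k, |p k| ≤ 5 / 8)
    (z : Fin n → signCube d) :
    Measure.pi (fun _ : Fin n => cubeLaw p) {z} = ENNReal.ofReal (sampleWeight p z) := by
  have := isProbabilityMeasure_cubeLaw hp
  rw [Measure.pi_singleton, sampleWeight,
    ENNReal.ofReal_prod_of_nonneg fun i _ => cubeWeight_nonneg hp (z i)]
  simp [cubeLaw_singleton]

theorem lintegral_trainLaw {d n : ℕ} {Θ : Type*} [MeasurableSpace Θ] {p : Fin d → ℝ}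
    (hp : ∀ k, |p k| ≤ 5 / 8) (A : Kernel (Fin n → signCube d) Θ) [IsMarkovKernel A]
    {f : (Fin n → signCube d) × Θ → ℝ≥0∞} (hf : Measurable f) :
    ∫⁻ ω, f ω ∂(trainLaw A (cubeLaw p)) =
      ∑ z, ENNReal.ofReal (sampleWeight p z) * ∫⁻ θ, f (z, θ) ∂(A z) := by
  have := isProbabilityMeasure_cubeLaw hp
  rw [trainLaw, Measure.lintegral_compProd hf, lintegral_fintype]
  exact Finset.sum_congr rfl fun z _ => by rw [pi_cubeLaw_singleton hp, mul_comm]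

theorem isProbabilityMeasure_trainLaw {Z Θ : Type*} [MeasurableSpace Z] [MeasurableSpace Θ]
    {n : ℕ} (A : Kernel (Fin n → Z) Θ) [IsMarkovKernel A] (D : Measure Z)
    [IsProbabilityMeasure D] : IsProbabilityMeasure (trainLaw A D) := by
  rw [trainLaw]; infer_instance

/-! ### Soundness of the score and the large deviations of partial sums -/

/-- The value of `T` makes the Chernoff bound with `v = h` equal to `ξ`. For empty `H` the score is
`0 < T`. -/
theorem cubeLaw_score_ge_le {d h : ℕ} {p : Fin d → ℝ} (hp : ∀ k, |p k| ≤ 5 / 8)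
    {H : Finset (Fin d)} (hH : H.card = h ∨ H = ∅) (hh : 0 < h) {ξ : ℝ} (hξ : 0 < ξ)
    {T : ℝ} (hT : 0 < T) (hT2 : T ^ 2 = 32 * h * Real.log (1 / ξ)) :
    cubeLaw p {u | T ≤ ∑ k ∈ H, centered p u.1 k} ≤ ENNReal.ofReal ξ := by
  classical
  rw [cubeLaw_apply, ← ENNReal.ofReal_sum_of_nonneg fun u _ => cubeWeight_nonneg hp u]
  refine ENNReal.ofReal_le_ofReal ?_
  rcases hH with hH | rfl
  · have hh' : (0 : ℝ) < h := by exact_mod_cast hh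
    have h1 := chernoff_sum (w := fun u : signCube d => cubeWeight p u.1)
      (X := fun u => ∑ k ∈ H, centered p u.1 k) (fun u => cubeWeight_nonneg hp u)
      (v := h) hh' hT.le (fun s => by simpa [hH] using mgf_cube_le hp H s)
    refine le_trans h1 (le_of_eq ?_)
    rw [hT2, one_div, Real.log_inv]
    have : -(32 * (h : ℝ) * -Real.log ξ / (32 * h)) = Real.log ξ := by field_simp
    rw [this, Real.exp_log hξ]
  · simp [not_le.2 hT, hξ.le]

/-- Some partial sum of the centered data is atypically large. -/
def Deviates {d n : ℕ} (p : Fin d → ℝ) (h : ℕ) (z : Fin n → signCube d) : Prop :=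
  ∃ I : Finset (Fin n), I.Nonempty ∧ ∃ H : Finset (Fin d), H.card = h ∧
    8 * Real.sqrt (Real.log d) * (Real.sqrt h * I.card + h * Real.sqrt I.card) ≤
      ∑ i ∈ I, ∑ k ∈ H, centered p (z i).1 k

/-- The sum is `(1 + 1 / d) ^ m ≤ e`. It makes a union bound over all subsets affordable when each
element costs a factor `1 / d`. -/
theorem sum_inv_pow_card_le (d m : ℕ) (hd : 0 < d) (hm : m ≤ d) :
    ∑ I : Finset (Fin m), (1 / (d : ℝ)) ^ I.card ≤ 3 := by
  have h := Fintype.sum_pow_mul_eq_add_pow (Fin m) (1 / (d : ℝ)) 1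
  simp only [one_pow, mul_one, Fintype.card_fin] at h
  rw [h]
  have hd' : (0 : ℝ) < d := by exact_mod_cast hd
  have hm' : (m : ℝ) ≤ d := by exact_mod_cast hm
  calc (1 / (d : ℝ) + 1) ^ m ≤ Real.exp (1 / d) ^ m := by
        gcongr; exact Real.add_one_le_exp _
    _ = Real.exp (m / d) := by rw [← Real.exp_nat_mul]; congr 1; ring
    _ ≤ Real.exp 1 := Real.exp_le_exp.2 (by rw [div_le_one hd']; exact hm')
    _ ≤ 3 := by linarith [Real.exp_one_lt_d9]

theorem prob_partial_sum_ge_le {d n h : ℕ} {p : Fin d → ℝ} (hp : ∀ k, |p k| ≤ 5 / 8) (hd : 1 ≤ d)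
    (hh : 0 < h) {I : Finset (Fin n)} (hI : I.Nonempty) {H : Finset (Fin d)} (hH : H.card = h) :
    ∑ z : Fin n → signCube d with 8 * Real.sqrt (Real.log d) *
        (Real.sqrt h * I.card + h * Real.sqrt I.card) ≤
        ∑ i ∈ I, ∑ k ∈ H, centered p (z i).1 k, sampleWeight p z ≤
      (1 / (d : ℝ)) ^ 2 * ((1 / (d : ℝ)) ^ I.card * (1 / (d : ℝ)) ^ H.card) := by
  have hN : 0 < I.card := hI.card_pos
  have hd0 : (0 : ℝ) < d := by exact_mod_cast hd
  have hd1 : (1 : ℝ) ≤ d := by exact_mod_cast hd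
  have hN' : (0 : ℝ) < I.card := by exact_mod_cast hN
  have hh' : (0 : ℝ) < h := by exact_mod_cast hh
  have hL : 0 ≤ Real.log d := Real.log_nonneg hd1
  set t := 8 * Real.sqrt (Real.log d) * (Real.sqrt h * I.card + h * Real.sqrt I.card) with ht
  have ht0 : 0 ≤ t := by positivity
  have h1 := chernoff_sum (w := fun z : Fin n → signCube d => sampleWeight p z)
      (X := fun z => ∑ i ∈ I, ∑ k ∈ H, centered p (z i).1 k) (fun z => sampleWeight_nonneg hp z)
      (v := I.card * h) (by positivity) ht0
      (fun s => by have := mgf_sample_le hp I H s; rwa [hH] at this)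
  refine h1.trans ?_
  -- The two summands of `t` are designed so that their squares alone yield the factor `|I| + h`;
  -- the cross term is dropped. The Chernoff exponent is then `2 log d (|I| + h)`: half pays for the
  -- choice of `I` and `H`, the rest leaves `d⁻²`.
  have ht2 : 64 * Real.log d * (I.card * h) * (I.card + h) ≤ t ^ 2 := by
    have e1 := Real.sq_sqrt hL
    have e2 := Real.sq_sqrt hh'.le
    have e3 := Real.sq_sqrt hN'.le
    have : t ^ 2 = 64 * Real.log d * (I.card * h) * (I.card + h) +
        128 * Real.log d * (Real.sqrt h * I.card * (h * Real.sqrt I.card)) := by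
      rw [ht]
      linear_combination (64 * (Real.sqrt h * I.card + h * Real.sqrt I.card) ^ 2) * e1 +
        64 * Real.log d * (I.card : ℝ) ^ 2 * e2 + 64 * Real.log d * (h : ℝ) ^ 2 * e3
    rw [this]
    have : 0 ≤ 128 * Real.log d * (Real.sqrt h * I.card * (h * Real.sqrt I.card)) := by
      positivity
    linarith
  have h2 : 2 * Real.log d * (I.card + h) ≤ t ^ 2 / (32 * (I.card * h)) := by
    rw [le_div_iff₀ (by positivity)]
    linarith
  have h3 : Real.exp (-(2 * Real.log d * (I.card + h))) =
      (1 / (d : ℝ)) ^ (2 * (I.card + h)) := by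
    rw [one_div, ← Real.exp_log hd0, ← Real.exp_neg, ← Real.exp_nat_mul, Real.log_exp]
    push_cast
    congr 1; ring
  rw [← pow_add, ← pow_add, hH]
  calc Real.exp (-(t ^ 2 / (32 * (I.card * h))))
      ≤ Real.exp (-(2 * Real.log d * (I.card + h))) := Real.exp_le_exp.2 (neg_le_neg h2)
    _ = _ := h3
    _ ≤ _ := pow_le_pow_of_le_one (by positivity) (by rw [div_le_one hd0]; exact hd1) (by omega)

open Classical in
theorem prob_deviates_le {d n h : ℕ} {p : Fin d → ℝ} (hp : ∀ k, |p k| ≤ 5 / 8) (hd : 1 ≤ d)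
    (hn : n ≤ d) (hh : 0 < h) :
    ∑ z : Fin n → signCube d, (if Deviates p h z then sampleWeight p z else 0) ≤
      9 / (d : ℝ) ^ 2 := by
  set E : Finset (Fin n) → Finset (Fin d) → (Fin n → signCube d) → Prop := fun I H z =>
    8 * Real.sqrt (Real.log d) * (Real.sqrt h * I.card + h * Real.sqrt I.card) ≤
      ∑ i ∈ I, ∑ k ∈ H, centered p (z i).1 k with hE
  have hw := fun z : Fin n → signCube d => sampleWeight_nonneg hp z
  have h1 : ∀ z : Fin n → signCube d, (if Deviates p h z then sampleWeight p z else 0) ≤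
      ∑ I : Finset (Fin n), ∑ H : Finset (Fin d),
        if (I.Nonempty ∧ H.card = h) ∧ E I H z then sampleWeight p z else 0 := by
    intro z
    have hnn : ∀ (I : Finset (Fin n)) (H : Finset (Fin d)),
        0 ≤ if (I.Nonempty ∧ H.card = h) ∧ E I H z then sampleWeight p z else 0 :=
      fun I H => by split_ifs <;> first | exact hw z | exact le_rfl
    split_ifs with hz
    · obtain ⟨I, hI, H, hH, hIH⟩ := hz
      refine le_trans ?_ (Finset.single_le_sum (fun I _ => Finset.sum_nonneg fun H _ => hnn I H)
        (Finset.mem_univ I))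
      refine le_trans ?_ (Finset.single_le_sum (fun H _ => hnn I H) (Finset.mem_univ H))
      rw [if_pos ⟨⟨hI, hH⟩, hIH⟩]
    · exact Finset.sum_nonneg fun I _ => Finset.sum_nonneg fun H _ => hnn I H
  refine (Finset.sum_le_sum fun z _ => h1 z).trans ?_
  rw [Finset.sum_comm]
  have h2 : ∀ (I : Finset (Fin n)) (H : Finset (Fin d)), ∑ z : Fin n → signCube d,
      (if (I.Nonempty ∧ H.card = h) ∧ E I H z then sampleWeight p z else 0) ≤
      (1 / (d : ℝ)) ^ 2 * ((1 / (d : ℝ)) ^ I.card * (1 / (d : ℝ)) ^ H.card) := by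
    intro I H
    by_cases hIH : I.Nonempty ∧ H.card = h
    · simp only [hIH, true_and, and_self]
      rw [← Finset.sum_filter]
      convert prob_partial_sum_ge_le hp hd hh hIH.1 hIH.2
      exact hIH.2.symm
    · simp only [hIH, false_and, if_false, Finset.sum_const_zero]
      positivity
  calc ∑ I : Finset (Fin n), ∑ z : Fin n → signCube d, ∑ H : Finset (Fin d),
        (if (I.Nonempty ∧ H.card = h) ∧ E I H z then sampleWeight p z else 0)
      = ∑ I : Finset (Fin n), ∑ H : Finset (Fin d), ∑ z : Fin n → signCube d,
        (if (I.Nonempty ∧ H.card = h) ∧ E I H z then sampleWeight p z else 0) :=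
        Finset.sum_congr rfl fun I _ => Finset.sum_comm
    _ ≤ ∑ I : Finset (Fin n), ∑ H : Finset (Fin d),
        (1 / (d : ℝ)) ^ 2 * ((1 / (d : ℝ)) ^ I.card * (1 / (d : ℝ)) ^ H.card) :=
        Finset.sum_le_sum fun I _ => Finset.sum_le_sum fun H _ => h2 I H
    _ = (1 / (d : ℝ)) ^ 2 * ((∑ I : Finset (Fin n), (1 / (d : ℝ)) ^ I.card) *
        ∑ H : Finset (Fin d), (1 / (d : ℝ)) ^ H.card) := by
        rw [Finset.sum_mul_sum, Finset.mul_sum]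
        exact Finset.sum_congr rfl fun I _ => by rw [Finset.mul_sum]
    _ ≤ (1 / (d : ℝ)) ^ 2 * (3 * 3) := by
        gcongr
        · exact sum_inv_pow_card_le d n hd hn
        · exact sum_inv_pow_card_le d d hd le_rfl
    _ = _ := by rw [div_pow]; ring

/-- The number of sample points whose score reaches `T`. -/
def tracedCount {d n : ℕ} (p : Fin d → ℝ) (T : ℝ) (z : Fin n → signCube d)
    (H : Finset (Fin d)) : ℕ :=
  {i : Fin n | T ≤ ∑ k ∈ H, centered p (z i).1 k}.ncard

open Classical in
-- Untraced points contribute at most `T` each. The traced points form one of the sets `I`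
-- controlled when `Deviates` fails; when it holds, every centered entry is bounded by `4`.
theorem sum_scores_le {d n h : ℕ} {p : Fin d → ℝ} (hp : ∀ k, |p k| ≤ 5 / 8)
    {H : Finset (Fin d)} (hH : H.card = h ∨ H = ∅) {T : ℝ} (hT : 0 < T)
    (z : Fin n → signCube d) :
    ∑ i, ∑ k ∈ H, centered p (z i).1 k ≤
      n * T + 8 * Real.sqrt (Real.log d) *
        (Real.sqrt h * tracedCount p T z H + h * Real.sqrt (tracedCount p T z H)) +
      if Deviates p h z then 4 * (n * h : ℝ) else 0 := by
  set ρ := 8 * Real.sqrt (Real.log d) with hρ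
  have hρ0 : 0 ≤ ρ := by positivity
  rcases hH with hH | rfl
  swap
  · simp only [Finset.sum_empty, Finset.sum_const_zero]
    have : 0 ≤ if Deviates p h z then 4 * (n * h : ℝ) else 0 := by split_ifs <;> positivity
    positivity
  set I : Finset (Fin n) := {i | T ≤ ∑ k ∈ H, centered p (z i).1 k} with hI
  have hc : tracedCount p T z H = I.card := by
    rw [tracedCount, ← Set.ncard_coe_finset]; congr 1; ext i; simp [hI]
  rw [hc]
  have h1 : ∑ i ∈ Iᶜ, ∑ k ∈ H, centered p (z i).1 k ≤ n * T := by
    calc ∑ i ∈ Iᶜ, ∑ k ∈ H, centered p (z i).1 k ≤ ∑ i ∈ Iᶜ, T :=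
          Finset.sum_le_sum fun i hi => by
            simp only [hI, Finset.mem_compl, Finset.mem_filter, Finset.mem_univ, true_and,
              not_le] at hi
            exact hi.le
      _ = (Iᶜ.card : ℝ) * T := by simp
      _ ≤ n * T := by
          gcongr
          simpa using Finset.card_le_univ Iᶜ
  have h2 : ∑ i ∈ I, ∑ k ∈ H, centered p (z i).1 k ≤
      ρ * (Real.sqrt h * I.card + h * Real.sqrt I.card) +
      if Deviates p h z then 4 * (n * h : ℝ) else 0 := by
    split_ifs with hz
    · have : ∑ i ∈ I, ∑ k ∈ H, centered p (z i).1 k ≤ 4 * (n * h : ℝ) := by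
        calc ∑ i ∈ I, ∑ k ∈ H, centered p (z i).1 k ≤ ∑ i ∈ I, ∑ k ∈ H, (4 : ℝ) :=
              Finset.sum_le_sum fun i _ => Finset.sum_le_sum fun k _ =>
                (le_abs_self _).trans (abs_centered_le hp (z i) k)
          _ = (I.card : ℝ) * (h * 4) := by simp [hH]
          _ ≤ n * (h * 4) := by
              gcongr
              simpa using Finset.card_le_univ I
          _ = _ := by ring
      have : 0 ≤ ρ * (Real.sqrt h * I.card + h * Real.sqrt I.card) := by positivity
      linarith
    · rcases I.eq_empty_or_nonempty with h0 | h0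
      · simp [h0]
      · by_contra hcon
        exact hz ⟨I, h0, H, hH, by linarith⟩
  rw [← Finset.sum_add_sum_compl I]
  linarith

/-! ### Expectations over the output of the algorithm. -/

theorem measurable_tracedCount {d n : ℕ} {H : (Fin d → ℝ) → Finset (Fin d)}
    (hHm : ∀ k, MeasurableSet {θ | k ∈ H θ}) (p : Fin d → ℝ) (T : ℝ) (z : Fin n → signCube d) :
    Measurable fun θ => (tracedCount p T z (H θ) : ℝ) := by
  classical
  have hs : ∀ i, Measurable fun θ => ∑ k ∈ H θ, centered p (z i).1 k := fun i => by
    have : (fun θ => ∑ k ∈ H θ, centered p (z i).1 k) =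
        fun θ => ∑ k, if k ∈ H θ then centered p (z i).1 k else 0 := by
      ext θ; rw [Finset.sum_ite_mem, Finset.univ_inter]
    rw [this]
    exact Finset.measurable_sum _ fun k _ => Measurable.ite (hHm k) measurable_const
      measurable_const
  have : (fun θ => (tracedCount p T z (H θ) : ℝ)) =
      fun θ => ∑ i, if T ≤ ∑ k ∈ H θ, centered p (z i).1 k then (1 : ℝ) else 0 := by
    ext θ
    rw [tracedCount, Finset.sum_boole, Set.ncard_eq_toFinset_card']
    simp
  rw [this]
  exact Finset.measurable_sum _ fun i _ => Measurable.ite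
    (measurableSet_le measurable_const (hs i)) measurable_const measurable_const

theorem tracedCount_le {d n : ℕ} (p : Fin d → ℝ) (T : ℝ) (z : Fin n → signCube d)
    (H : Finset (Fin d)) : tracedCount p T z H ≤ n := by
  simpa [tracedCount] using Set.ncard_le_card {i : Fin n | T ≤ ∑ k ∈ H, centered p (z i).1 k}

theorem integrable_tracedCount {d n : ℕ} {H : (Fin d → ℝ) → Finset (Fin d)}
    (hHm : ∀ k, MeasurableSet {θ | k ∈ H θ}) (p : Fin d → ℝ) (T : ℝ) (z : Fin n → signCube d)
    (μ : Measure (Fin d → ℝ)) [IsFiniteMeasure μ] :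
    Integrable (fun θ => (tracedCount p T z (H θ) : ℝ)) μ :=
  Integrable.of_bound (measurable_tracedCount hHm p T z).aestronglyMeasurable n
    (Filter.Eventually.of_forall fun θ => by
      rw [Real.norm_natCast]; exact_mod_cast tracedCount_le p T z (H θ))

/-- The expectation of a sum over a random finite set. -/
theorem integral_sum_mem {d : ℕ} {H : (Fin d → ℝ) → Finset (Fin d)}
    (hHm : ∀ k, MeasurableSet {θ | k ∈ H θ}) (μ : Measure (Fin d → ℝ)) [IsFiniteMeasure μ]
    (c : Fin d → ℝ) : Integrable (fun θ => ∑ k ∈ H θ, c k) μ ∧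
      ∫ θ, ∑ k ∈ H θ, c k ∂μ = ∑ k, μ.real {θ | k ∈ H θ} * c k := by
  classical
  have e : (fun θ => ∑ k ∈ H θ, c k) =
      fun θ => ∑ k, {θ | k ∈ H θ}.indicator (fun _ => c k) θ := by
    ext θ
    simp only [Set.indicator_apply, Set.mem_ofPred_eq]
    rw [Finset.sum_ite_mem, Finset.univ_inter]
  have hi : ∀ k ∈ Finset.univ, Integrable ({θ | k ∈ H θ}.indicator fun _ => c k) μ :=
    fun k _ => (integrable_const _).indicator (hHm k)
  rw [e]
  refine ⟨integrable_finsetSum _ hi, ?_⟩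
  rw [integral_finsetSum _ hi]
  exact Finset.sum_congr rfl fun k _ => by
    rw [integral_indicator_const _ (hHm k), smul_eq_mul]

/-- The expected total score of the sample. -/
def totalScore {d n : ℕ} (A : Kernel (Fin n → signCube d) (Fin d → ℝ))
    (H : (Fin d → ℝ) → Finset (Fin d)) (p : Fin d → ℝ) : ℝ :=
  ∑ k, ∑ z : Fin n → signCube d,
    sampleWeight p z * ((A z).real {θ | k ∈ H θ} * ∑ i, centered p (z i).1 k)

/-- Averaging `sum_scores_le` works because its bound is concave in the traced count. The last term
is `4 n h` times the deviation probability `9 / d ^ 2`, with `n ≤ d`. -/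
theorem totalScore_le {d n h : ℕ} {p : Fin d → ℝ} (hp : ∀ k, |p k| ≤ 5 / 8) (hd : 1 ≤ d)
    (hn : n ≤ d) (hh : 0 < h) (A : Kernel (Fin n → signCube d) (Fin d → ℝ)) [IsMarkovKernel A]
    {H : (Fin d → ℝ) → Finset (Fin d)} (hHm : ∀ k, MeasurableSet {θ | k ∈ H θ})
    (hH : ∀ θ, (H θ).card = h ∨ H θ = ∅) {T M : ℝ} (hT : 0 < T) (hM : 0 < M)
    (hcount : ∑ z, sampleWeight p z * ∫ θ, (tracedCount p T z (H θ) : ℝ) ∂(A z) ≤ M) :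
    totalScore A H p ≤
      n * T + 8 * Real.sqrt (Real.log d) * (Real.sqrt h * M + h * Real.sqrt M) + 36 * h / d := by
  classical
  set ρ := 8 * Real.sqrt (Real.log d) with hρ
  have hρ0 : 0 ≤ ρ := by positivity
  have hd0 : (0 : ℝ) < d := by exact_mod_cast hd
  have hsM : 0 < Real.sqrt M := Real.sqrt_pos.2 hM
  have hw := fun z : Fin n → signCube d => sampleWeight_nonneg hp z
  set a : ℝ := ρ * (Real.sqrt h + h / (2 * Real.sqrt M)) with ha
  set b : ℝ := n * T + ρ * h * Real.sqrt M / 2 with hb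
  -- The tangent line of the square root at `M` replaces Jensen's inequality and keeps everything
  -- affine in the count.
  have hsq : ∀ N : ℕ, Real.sqrt N ≤ N / (2 * Real.sqrt M) + Real.sqrt M / 2 := fun N => by
    have e := Real.sq_sqrt (Nat.cast_nonneg (α := ℝ) N)
    have : N / (2 * Real.sqrt M) + Real.sqrt M / 2 - Real.sqrt N =
        (Real.sqrt N - Real.sqrt M) ^ 2 / (2 * Real.sqrt M) := by
      field_simp
      linear_combination -e
    have : 0 ≤ (Real.sqrt N - Real.sqrt M) ^ 2 / (2 * Real.sqrt M) := by positivity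
    linarith
  have h1 : ∀ z : Fin n → signCube d, ∑ k, (A z).real {θ | k ∈ H θ} *
      ∑ i, centered p (z i).1 k ≤ a * ∫ θ, (tracedCount p T z (H θ) : ℝ) ∂(A z) + b +
        if Deviates p h z then 4 * (n * h : ℝ) else 0 := by
    intro z
    set e : ℝ := if Deviates p h z then 4 * (n * h : ℝ) else 0 with he
    obtain ⟨hi, hI⟩ := integral_sum_mem hHm (A z) (fun k => ∑ i, centered p (z i).1 k)
    have hN := integrable_tracedCount hHm p T z (A z)
    have e2 : a * ∫ θ, (tracedCount p T z (H θ) : ℝ) ∂(A z) + b + e =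
        ∫ θ, (a * (tracedCount p T z (H θ) : ℝ) + (b + e)) ∂(A z) := by
      rw [integral_add (hN.const_mul a) (integrable_const _), integral_const_mul]
      simp; ring
    rw [← hI, e2]
    refine integral_mono hi ((hN.const_mul a).add (integrable_const _)) fun θ => ?_
    have h3 := sum_scores_le hp (hH θ) hT z
    have h4 := hsq (tracedCount p T z (H θ))
    have h5 := mul_le_mul_of_nonneg_left h4 (mul_nonneg hρ0 (Nat.cast_nonneg (α := ℝ) h))
    simp only
    rw [Finset.sum_comm] at h3
    refine h3.trans ?_
    rw [← he, ha, hb]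
    have e6 : ρ * (Real.sqrt h + h / (2 * Real.sqrt M)) * (tracedCount p T z (H θ) : ℝ) =
      ρ * (Real.sqrt h * tracedCount p T z (H θ)) +
        ρ * h * (tracedCount p T z (H θ) / (2 * Real.sqrt M)) := by ring
    rw [e6]
    linarith
  have h2 : totalScore A H p = ∑ z : Fin n → signCube d, sampleWeight p z *
      ∑ k, (A z).real {θ | k ∈ H θ} * ∑ i, centered p (z i).1 k := by
    rw [totalScore, Finset.sum_comm]
    exact Finset.sum_congr rfl fun z _ => by rw [Finset.mul_sum]
  rw [h2]
  refine (Finset.sum_le_sum fun z _ => mul_le_mul_of_nonneg_left (h1 z) (hw z)).trans ?_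
  have h3 : ∑ z : Fin n → signCube d, sampleWeight p z *
      (a * ∫ θ, (tracedCount p T z (H θ) : ℝ) ∂(A z) + b +
        if Deviates p h z then 4 * (n * h : ℝ) else 0) =
      a * ∑ z, sampleWeight p z * ∫ θ, (tracedCount p T z (H θ) : ℝ) ∂(A z) + b +
      4 * (n * h) * ∑ z : Fin n → signCube d, if Deviates p h z then sampleWeight p z else 0 := by
    rw [Finset.mul_sum, Finset.mul_sum]
    conv_rhs => rw [← mul_one b, ← sum_sampleWeight n p, Finset.mul_sum]
    rw [← Finset.sum_add_distrib, ← Finset.sum_add_distrib]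
    exact Finset.sum_congr rfl fun z _ => by split_ifs <;> ring
  rw [h3]
  have ha0 : 0 ≤ a := by positivity
  have h4 := mul_le_mul_of_nonneg_left hcount ha0
  have h5 := mul_le_mul_of_nonneg_left (prob_deviates_le hp hd hn hh)
    (show (0 : ℝ) ≤ 4 * (n * h) by positivity)
  have h6 : 4 * (n * h : ℝ) * (9 / (d : ℝ) ^ 2) ≤ 36 * h / d := by
    have : (n : ℝ) ≤ d := by exact_mod_cast hn
    calc 4 * (n * h : ℝ) * (9 / (d : ℝ) ^ 2) ≤ 4 * (d * h : ℝ) * (9 / (d : ℝ) ^ 2) := by gcongr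
      _ = _ := by field_simp; ring
  have h7 : a * M + b = n * T + ρ * (Real.sqrt h * M + h * Real.sqrt M) := by
    have e := Real.sq_sqrt hM.le
    rw [ha, hb]
    field_simp
    linear_combination (-ρ * h) * e
  linarith

/-! ### The truncated Laplace prior -/

/-- The law on `[-B, B]` with density proportional to `exp (-lam |x|)`. -/
def laplacePrior (lam B : ℝ) : Measure ℝ :=
  (volume.restrict (Set.Icc (-B) B)).withDensity fun x =>
    ENNReal.ofReal (lam / (2 * (1 - Real.exp (-(lam * B)))) * Real.exp (-(lam * |x|)))

theorem hasDerivAt_exp_const_mul (c x : ℝ) :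
    HasDerivAt (fun x => Real.exp (c * x)) (Real.exp (c * x) * c) x := by
  simpa using ((hasDerivAt_id x).const_mul c).exp

theorem hasDerivAt_exp_neg_mul (c x : ℝ) :
    HasDerivAt (fun x => Real.exp (-(c * x))) (-(Real.exp (-(c * x)) * c)) x := by
  simpa using hasDerivAt_exp_const_mul (-c) x

theorem integral_exp_neg_mul {lam : ℝ} (hl : 0 < lam) (a b : ℝ) :
    ∫ x in a..b, Real.exp (-(lam * x)) =
      (Real.exp (-(lam * a)) - Real.exp (-(lam * b))) / lam := by
  have h : ∀ x ∈ Set.uIcc a b, HasDerivAt (fun x => -(Real.exp (-(lam * x)) / lam))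
      (Real.exp (-(lam * x))) x := fun x _ => by
    refine ((hasDerivAt_exp_neg_mul lam x).div_const lam).fun_neg.congr_deriv ?_
    field_simp
  rw [intervalIntegral.integral_eq_sub_of_hasDerivAt h (by
    apply Continuous.intervalIntegrable; fun_prop)]
  ring

theorem integral_exp_neg_abs {lam B : ℝ} (hl : 0 < lam) (hB : 0 ≤ B) :
    ∫ x in -B..B, Real.exp (-(lam * |x|)) = 2 * (1 - Real.exp (-(lam * B))) / lam := by
  have hc : Continuous fun x : ℝ => Real.exp (-(lam * |x|)) := by fun_prop
  rw [← intervalIntegral.integral_add_adjacent_intervals (hc.intervalIntegrable (-B) 0)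
    (hc.intervalIntegrable 0 B)]
  have h1 : ∫ x in (0 : ℝ)..B, Real.exp (-(lam * |x|)) =
      (1 - Real.exp (-(lam * B))) / lam := by
    rw [intervalIntegral.integral_congr (g := fun x => Real.exp (-(lam * x))) fun x hx => ?_,
      integral_exp_neg_mul hl]
    · simp
    · rw [Set.uIcc_of_le hB] at hx
      simp [abs_of_nonneg hx.1]
  have h2 := intervalIntegral.integral_comp_neg (a := 0) (b := B)
    (fun x : ℝ => Real.exp (-(lam * |x|)))
  simp only [abs_neg, neg_zero] at h2
  rw [← h2, h1]
  ring

theorem laplacePrior_norm_pos {lam B : ℝ} (hl : 0 < lam) (hB : 0 < B) :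
    0 < 1 - Real.exp (-(lam * B)) := by
  have : Real.exp (-(lam * B)) < 1 := Real.exp_lt_one_iff.2 (by nlinarith)
  linarith

theorem integral_laplacePrior {lam B : ℝ} (hl : 0 < lam) (hB : 0 < B) (f : ℝ → ℝ) :
    ∫ x, f x ∂(laplacePrior lam B) = lam / (2 * (1 - Real.exp (-(lam * B)))) *
      ∫ x in Set.Icc (-B) B, Real.exp (-(lam * |x|)) * f x := by
  have hK := laplacePrior_norm_pos hl hB
  rw [laplacePrior, integral_withDensity_eq_integral_toReal_smul (by fun_prop)
    (Filter.Eventually.of_forall fun x => ENNReal.ofReal_lt_top), ← integral_const_mul]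
  refine integral_congr_ae (Filter.Eventually.of_forall fun x => ?_)
  simp only [smul_eq_mul]
  rw [ENNReal.toReal_ofReal (by positivity)]
  ring

theorem isProbabilityMeasure_laplacePrior {lam B : ℝ} (hl : 0 < lam) (hB : 0 < B) :
    IsProbabilityMeasure (laplacePrior lam B) := by
  have hK := laplacePrior_norm_pos hl hB
  have hc : Continuous fun x : ℝ =>
      lam / (2 * (1 - Real.exp (-(lam * B)))) * Real.exp (-(lam * |x|)) := by fun_prop
  constructor
  rw [laplacePrior, withDensity_apply _ MeasurableSet.univ, Measure.restrict_univ,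
    ← ofReal_integral_eq_lintegral_ofReal (hc.integrableOn_Icc)
      (Filter.Eventually.of_forall fun x => by positivity),
    integral_const_mul, integral_Icc_eq_integral_Ioc,
    ← intervalIntegral.integral_of_le (by linarith), integral_exp_neg_abs hl hB.le]
  rw [← ENNReal.ofReal_one]
  congr 1
  field_simp

theorem ae_laplacePrior_abs_le (lam B : ℝ) : ∀ᵐ x ∂(laplacePrior lam B), |x| ≤ B := by
  refine (withDensity_absolutelyContinuous _ _).ae_le ?_
  filter_upwards [ae_restrict_mem measurableSet_Icc] with x hx
  exact abs_le.2 hx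

theorem laplacePrior_Ici_ge {lam B t : ℝ} (hl : 0 < lam) (hB : 0 < B) (ht : 0 ≤ t)
    (htB : t ≤ B) : (Real.exp (-(lam * t)) - Real.exp (-(lam * B))) / 2 ≤
      (laplacePrior lam B).real (Set.Ici t) := by
  have hK := laplacePrior_norm_pos hl hB
  rw [← integral_indicator_one measurableSet_Ici, integral_laplacePrior hl hB]
  have e : ∀ x, Real.exp (-(lam * |x|)) * (Set.Ici t).indicator (1 : ℝ → ℝ) x =
      (Set.Ici t).indicator (fun x => Real.exp (-(lam * |x|))) x := fun x => by
    simp only [Set.indicator_apply]; split_ifs <;> simp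
  simp only [e]
  have e2 : Set.Icc (-B) B ∩ Set.Ici t = Set.Icc t B := by
    ext x; simp only [Set.mem_inter_iff, Set.mem_Icc, Set.mem_Ici]
    constructor
    · rintro ⟨⟨_, h⟩, h'⟩; exact ⟨h', h⟩
    · rintro ⟨h', h⟩; exact ⟨⟨by linarith, h⟩, h'⟩
  rw [setIntegral_indicator measurableSet_Ici, e2, integral_Icc_eq_integral_Ioc,
    ← intervalIntegral.integral_of_le htB,
    intervalIntegral.integral_congr (g := fun x => Real.exp (-(lam * x))) fun x hx => ?_,
    integral_exp_neg_mul hl]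
  · have h1 : Real.exp (-(lam * B)) ≤ Real.exp (-(lam * t)) :=
      Real.exp_le_exp.2 (by nlinarith)
    have h2 := Real.exp_pos (-(lam * B))
    have e3 : lam / (2 * (1 - Real.exp (-(lam * B)))) *
        ((Real.exp (-(lam * t)) - Real.exp (-(lam * B))) / lam) =
        (Real.exp (-(lam * t)) - Real.exp (-(lam * B))) / (2 * (1 - Real.exp (-(lam * B)))) := by
      field_simp
    rw [e3]
    apply div_le_div_of_nonneg_left <;> linarith
  · rw [Set.uIcc_of_le htB] at hx
    simp [abs_of_nonneg (ht.trans hx.1)]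

/-- The sign of a real number, with value `-1` at `0`. -/
def leftSign (x : ℝ) : ℝ := if 0 < x then 1 else -1

theorem measurable_leftSign : Measurable leftSign :=
  Measurable.ite measurableSet_Ioi measurable_const measurable_const

theorem abs_leftSign (x : ℝ) : |leftSign x| = 1 := by
  rw [leftSign]; split_ifs <;> simp

/-- On each side of `0` the weighted integrand is the derivative of `exp (-(lam * |x|)) * g x`. The
two values at `0` cancel, leaving only `exp (-(lam * B)) * (g B - g (-B))`; since `exp (-(lam * B))
≤ 1 / 2`, the normalizing factor is at most `lam`. -/
theorem integral_deriv_sub_leftSign_ge {lam B : ℝ} (hl : 0 < lam) (hB : 0 < B)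
    (hBl : Real.exp (-(lam * B)) ≤ 1 / 2) {g g' : ℝ → ℝ} (hg : ∀ x, HasDerivAt g (g' x) x)
    (hg' : Continuous g') (h0 : 0 ≤ g B) (h1 : g (-B) ≤ 1) :
    -(lam * Real.exp (-(lam * B))) ≤
      ∫ x, (g' x - lam * (leftSign x * g x)) ∂(laplacePrior lam B) := by
  have hK := laplacePrior_norm_pos hl hB
  have hgc : Continuous g := continuous_iff_continuousAt.2 fun x => (hg x).continuousAt
  set F : ℝ → ℝ := fun x => Real.exp (-(lam * |x|)) * (g' x - lam * (leftSign x * g x)) with hF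
  have hr : Set.EqOn F (fun x => Real.exp (-(lam * x)) * (g' x - lam * g x)) (Set.uIoc 0 B) := by
    intro x hx
    rw [Set.uIoc_of_le hB.le] at hx
    simp only [hF, leftSign, if_pos hx.1, abs_of_pos hx.1, one_mul]
  have hs : Set.EqOn F (fun x => Real.exp (lam * x) * (g' x + lam * g x))
      (Set.uIoc (-B) 0) := by
    intro x hx
    rw [Set.uIoc_of_le (by linarith)] at hx
    simp only [hF, leftSign, if_neg (not_lt.2 hx.2), abs_of_nonpos hx.2]
    ring_nf
  have cr : Continuous fun x => Real.exp (-(lam * x)) * (g' x - lam * g x) := by fun_prop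
  have cs : Continuous fun x => Real.exp (lam * x) * (g' x + lam * g x) := by fun_prop
  have ir : ∫ x in (0 : ℝ)..B, F x = Real.exp (-(lam * B)) * g B - g 0 := by
    rw [intervalIntegral.integral_congr_ae (ae_of_all _ fun x hx => hr hx),
      intervalIntegral.integral_eq_sub_of_hasDerivAt
        (f := fun x => Real.exp (-(lam * x)) * g x) (fun x _ => ?_) (cr.intervalIntegrable _ _)]
    · simp
    · exact ((hasDerivAt_exp_neg_mul lam x).fun_mul (hg x)).congr_deriv (by ring)
  have is : ∫ x in -B..(0 : ℝ), F x = g 0 - Real.exp (-(lam * B)) * g (-B) := by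
    rw [intervalIntegral.integral_congr_ae (ae_of_all _ fun x hx => hs hx),
      intervalIntegral.integral_eq_sub_of_hasDerivAt
        (f := fun x => Real.exp (lam * x) * g x) (fun x _ => ?_) (cs.intervalIntegrable _ _)]
    · simp
    · exact ((hasDerivAt_exp_const_mul lam x).fun_mul (hg x)).congr_deriv (by ring)
  have Ir : IntervalIntegrable F volume 0 B := (cr.intervalIntegrable 0 B).congr hr.symm
  have Is : IntervalIntegrable F volume (-B) 0 := (cs.intervalIntegrable (-B) 0).congr hs.symm
  rw [integral_laplacePrior hl hB, integral_Icc_eq_integral_Ioc,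
    ← intervalIntegral.integral_of_le (by linarith),
    ← intervalIntegral.integral_add_adjacent_intervals Is Ir, ir, is]
  have h2 := Real.exp_pos (-(lam * B))
  have e1 : -Real.exp (-(lam * B)) ≤ g 0 - Real.exp (-(lam * B)) * g (-B) +
      (Real.exp (-(lam * B)) * g B - g 0) := by nlinarith
  have e2 : lam / (2 * (1 - Real.exp (-(lam * B)))) ≤ lam := by
    apply div_le_self hl.le; linarith
  have e3 : 0 ≤ lam / (2 * (1 - Real.exp (-(lam * B)))) := by positivity
  nlinarith [mul_le_mul_of_nonneg_left e1 e3, mul_le_mul_of_nonneg_right e2 h2.le]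

/-! ### Product priors -/

theorem measurable_update_prod {d : ℕ} (k : Fin d) :
    Measurable fun q : (Fin d → ℝ) × ℝ => Function.update q.1 k q.2 :=
  measurable_pi_iff.2 fun j => by
    by_cases h : j = k
    · subst h; simpa using measurable_snd
    · simp only [Function.update_of_ne h]
      exact (measurable_pi_apply j).comp measurable_fst

/-- Resampling one coordinate independently preserves a product law; this lets a one-dimensional
inequality be applied with the other coordinates frozen. -/
theorem map_update_pi {d : ℕ} (ν : Measure ℝ) [IsProbabilityMeasure ν] (k : Fin d) :
    ((Measure.pi fun _ : Fin d => ν).prod ν).map (fun q => Function.update q.1 k q.2) =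
      Measure.pi fun _ : Fin d => ν := by
  symm
  refine Measure.pi_eq fun s hs => ?_
  have hm := measurable_update_prod (d := d) k
  rw [Measure.map_apply hm (MeasurableSet.univ_pi hs)]
  have e : (fun q : (Fin d → ℝ) × ℝ => Function.update q.1 k q.2) ⁻¹' Set.univ.pi s =
      (Set.univ.pi (Function.update s k Set.univ)) ×ˢ s k := by
    ext q
    simp only [Set.mem_preimage, Set.mem_pi, Set.mem_univ, true_implies, Set.mem_prod]
    constructor
    · refine fun h => ⟨fun j => ?_, by simpa using h k⟩
      by_cases hj : j = k
      · subst hj; simp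
      · simpa [Function.update_of_ne hj] using h j
    · rintro ⟨h, h'⟩ j
      by_cases hj : j = k
      · subst hj; simpa using h'
      · simpa [Function.update_of_ne hj] using h j
  rw [e, Measure.prod_prod, Measure.pi_pi, ← Finset.mul_prod_erase _ _ (Finset.mem_univ k),
    ← Finset.mul_prod_erase (Finset.univ) (fun j => ν (s j)) (Finset.mem_univ k)]
  simp only [Function.update_self, measure_univ, one_mul]
  rw [mul_comm]
  congr 1
  exact Finset.prod_congr rfl fun j hj => by
    rw [Function.update_of_ne (Finset.ne_of_mem_erase hj)]

theorem le_integral_pi_of_update {d : ℕ} {ν : Measure ℝ} [IsProbabilityMeasure ν] (k : Fin d)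
    {f : (Fin d → ℝ) → ℝ} (hf : Integrable f (Measure.pi fun _ : Fin d => ν)) {a : ℝ}
    (ha : ∀ᵐ p ∂(Measure.pi fun _ : Fin d => ν), a ≤ ∫ x, f (Function.update p k x) ∂ν) :
    a ≤ ∫ p, f p ∂(Measure.pi fun _ : Fin d => ν) := by
  have hm := measurable_update_prod (d := d) k
  have hf' := hf
  rw [← map_update_pi ν k] at hf'
  have hi := (integrable_map_measure hf'.aestronglyMeasurable hm.aemeasurable).1 hf'
  have e : ∫ p, f p ∂(Measure.pi fun _ : Fin d => ν) =
      ∫ p, ∫ x, f (Function.update p k x) ∂ν ∂(Measure.pi fun _ : Fin d => ν) := by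
    conv_lhs => rw [← map_update_pi ν k]
    rw [integral_map hm.aemeasurable hf'.aestronglyMeasurable]
    exact integral_prod _ hi
  rw [e]
  calc a = ∫ _, a ∂(Measure.pi fun _ : Fin d => ν) := by simp
    _ ≤ _ := integral_mono_ae (integrable_const _) hi.integral_prod_left ha

theorem ae_pi_abs_le {d : ℕ} {ν : Measure ℝ} [IsProbabilityMeasure ν] {B : ℝ}
    (h : ∀ᵐ x ∂ν, |x| ≤ B) : ∀ᵐ p ∂(Measure.pi fun _ : Fin d => ν), ∀ k, |p k| ≤ B :=
  ae_all_iff.2 fun k => (measurePreserving_eval (fun _ : Fin d => ν) k).quasiMeasurePreserving.ae h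

open Classical in
/-- A lower tail bound for the number of coordinates above a level. -/
theorem pi_card_lt_le {d : ℕ} (ν : Measure ℝ) [IsProbabilityMeasure ν] (t : ℝ) (h : ℕ) :
    (Measure.pi fun _ : Fin d => ν).real {p | (Finset.univ.filter fun k => t ≤ p k).card < h} ≤
      Real.exp (h - d * ν.real (Set.Ici t) / 2) := by
  set Q := Measure.pi fun _ : Fin d => ν with hQ
  set q := ν.real (Set.Ici t) with hq
  -- Exponential Markov inequality with parameter `1`: each coordinate above `t` costs a factor `exp
  -- (-1)`, and the mean `1 - (1 - exp (-1)) * q` is at most `exp (-(q / 2))`.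
  set φ : ℝ → ℝ := fun x => if t ≤ x then Real.exp (-1) else 1 with hφ
  have hφm : Measurable φ := Measurable.ite measurableSet_Ici measurable_const measurable_const
  have hφ0 : ∀ x, 0 ≤ φ x := fun x => by simp only [hφ]; split_ifs <;> positivity
  have e1 : ∫ x, φ x ∂ν ≤ Real.exp (-(q / 2)) := by
    have e : ∀ x, φ x = 1 - (1 - Real.exp (-1)) * (Set.Ici t).indicator (1 : ℝ → ℝ) x :=
      fun x => by
        simp only [hφ, Set.indicator_apply, Set.mem_Ici]
        split_ifs <;> simp
    have hi : Integrable ((Set.Ici t).indicator (1 : ℝ → ℝ)) ν :=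
      (integrable_const (1 : ℝ)).indicator measurableSet_Ici
    simp only [e]
    rw [integral_sub (integrable_const _) (hi.const_mul _), integral_const_mul,
      integral_indicator_one measurableSet_Ici, ← hq]
    have h1 : Real.exp (-1) ≤ 1 / 2 := by
      rw [Real.exp_neg, inv_le_comm₀ (Real.exp_pos 1) (by norm_num)]
      linarith [Real.exp_one_gt_d9]
    have hq0 : 0 ≤ q := measureReal_nonneg
    have h2 := Real.add_one_le_exp (-(q / 2))
    simp only [integral_const, probReal_univ, smul_eq_mul, mul_one]
    nlinarith
  have e2 : ∫ p, ∏ k, φ (p k) ∂Q = (∫ x, φ x ∂ν) ^ d := by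
    rw [hQ, integral_fintype_prod_eq_prod (fun _ : Fin d => φ)]
    simp
  have hpm : Measurable fun p : Fin d → ℝ => ∏ k, φ (p k) :=
    Finset.measurable_prod _ fun k _ => hφm.comp (measurable_pi_apply k)
  have hprod : ∀ p : Fin d → ℝ, ∏ k, φ (p k) =
      Real.exp (-((Finset.univ.filter fun k => t ≤ p k).card : ℝ)) := fun p => by
    simp only [hφ]
    rw [Finset.prod_ite]
    simp [← Real.exp_nat_mul]
  have hpi : Integrable (fun p : Fin d → ℝ => Real.exp h * ∏ k, φ (p k)) Q :=
    (Integrable.of_bound hpm.aestronglyMeasurable 1 (Filter.Eventually.of_forall fun p => by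
      rw [hprod, Real.norm_eq_abs, Real.abs_exp]
      exact Real.exp_le_one_iff.2 (by simp))).const_mul _
  set S := {p : Fin d → ℝ | (Finset.univ.filter fun k => t ≤ p k).card < h} with hS
  have hms : MeasurableSet S := by
    have hN : Measurable fun p : Fin d → ℝ => (Finset.univ.filter fun k => t ≤ p k).card := by
      simp only [Finset.card_filter]
      exact Finset.measurable_sum _ fun k _ => Measurable.ite
        (measurableSet_le measurable_const (measurable_pi_apply k)) measurable_const
        measurable_const
    exact measurableSet_lt hN measurable_const
  rw [← integral_indicator_one hms]
  calc _ ≤ ∫ p, Real.exp h * ∏ k, φ (p k) ∂Q := by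
        refine integral_mono ((integrable_const (1 : ℝ)).indicator hms) hpi fun p => ?_
        simp only
        by_cases hp : p ∈ S
        · rw [Set.indicator_of_mem hp, hprod, ← Real.exp_add]
          have hp' : (Finset.univ.filter fun k => t ≤ p k).card < h := hp
          have : ((Finset.univ.filter fun k => t ≤ p k).card : ℝ) < h := by exact_mod_cast hp'
          exact Real.one_le_exp (by linarith)
        · rw [Set.indicator_of_notMem hp, hprod]
          positivity
    _ = Real.exp h * (∫ x, φ x ∂ν) ^ d := by rw [integral_const_mul, e2]
    _ ≤ Real.exp h * Real.exp (-(q / 2)) ^ d := by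
        gcongr
    _ = _ := by
        rw [← Real.exp_nat_mul, ← Real.exp_add]
        congr 1
        ring

/-! ### The fingerprinting identity -/

/-- The expectation of `F` over an i.i.d. sample. -/
def sampleExp {d n : ℕ} (p : Fin d → ℝ) (F : (Fin n → signCube d) → ℝ) : ℝ :=
  ∑ z, sampleWeight p z * F z

theorem sampleExp_mono {d n : ℕ} {p : Fin d → ℝ} (hp : ∀ k, |p k| ≤ 5 / 8)
    {F G : (Fin n → signCube d) → ℝ} (h : ∀ z, F z ≤ G z) : sampleExp p F ≤ sampleExp p G :=
  Finset.sum_le_sum fun z _ => mul_le_mul_of_nonneg_left (h z) (sampleWeight_nonneg hp z)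

theorem sampleExp_const {d : ℕ} (n : ℕ) (p : Fin d → ℝ) (c : ℝ) :
    sampleExp p (fun _ : Fin n → signCube d => c) = c := by
  rw [sampleExp, ← Finset.sum_mul, sum_sampleWeight, one_mul]

theorem abs_sampleExp_le {d n : ℕ} {p : Fin d → ℝ} (hp : ∀ k, |p k| ≤ 5 / 8)
    {F : (Fin n → signCube d) → ℝ} {c : ℝ} (h : ∀ z, |F z| ≤ c) : |sampleExp p F| ≤ c := by
  rw [abs_le]
  constructor
  · rw [← sampleExp_const n p (-c)]
    exact sampleExp_mono hp fun z => (abs_le.1 (h z)).1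
  · rw [← sampleExp_const n p c]
    exact sampleExp_mono hp fun z => (abs_le.1 (h z)).2

theorem sampleWeight_update {d n : ℕ} (p : Fin d → ℝ) (k : Fin d) (x : ℝ)
    (z : Fin n → signCube d) : sampleWeight (Function.update p k x) z =
      (∏ i, (1 + (z i).1 k * x) / 2) *
        ∏ i, ∏ j ∈ Finset.univ.erase k, (1 + (z i).1 j * p j) / 2 := by
  rw [sampleWeight, ← Finset.prod_mul_distrib]
  refine Finset.prod_congr rfl fun i _ => ?_
  rw [cubeWeight, ← Finset.mul_prod_erase _ _ (Finset.mem_univ k), Function.update_self]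
  congr 1
  exact Finset.prod_congr rfl fun j hj => by
    rw [Function.update_of_ne (Finset.ne_of_mem_erase hj)]

/-- The derivative of an expectation in the mean of one coordinate is a sum of correlations. -/
theorem exists_deriv_sampleExp {d n : ℕ} (p : Fin d → ℝ) (k : Fin d)
    (F : (Fin n → signCube d) → ℝ) : ∃ g' : ℝ → ℝ, Continuous g' ∧
      (∀ x, HasDerivAt (fun x => sampleExp (Function.update p k x) F) (g' x) x) ∧
      ∀ x, |x| ≤ 5 / 8 → g' x = sampleExp (Function.update p k x)
        fun z => F z * ∑ i, centered (Function.update p k x) (z i).1 k := by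
  set R : (Fin n → signCube d) → ℝ := fun z =>
    ∏ i, ∏ j ∈ Finset.univ.erase k, (1 + (z i).1 j * p j) / 2 with hR
  refine ⟨fun x => ∑ z : Fin n → signCube d, (∑ i, (∏ j ∈ Finset.univ.erase i,
    (1 + (z j).1 k * x) / 2) • ((z i).1 k / 2)) * R z * F z, ?_, fun x => ?_, fun x hx => ?_⟩
  · fun_prop
  · simp only [sampleExp, sampleWeight_update]
    refine HasDerivAt.fun_sum fun z _ => ((HasDerivAt.fun_finsetProd fun i _ => ?_).mul_const
      (R z)).mul_const (F z)
    have := (((hasDerivAt_id x).const_mul ((z i).1 k)).const_add 1).div_const 2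
    simpa using this
  · simp only [sampleExp, sampleWeight_update]
    refine Finset.sum_congr rfl fun z _ => ?_
    have hx' := abs_le.1 hx
    have e : ∀ i, (∏ j ∈ Finset.univ.erase i, (1 + (z j).1 k * x) / 2) • ((z i).1 k / 2) =
        (∏ j, (1 + (z j).1 k * x) / 2) * centered (Function.update p k x) (z i).1 k := by
      intro i
      rw [← Finset.mul_prod_erase _ _ (Finset.mem_univ i), centered, Function.update_self,
        smul_eq_mul]
      have h1 : 1 - x ^ 2 ≠ 0 := by nlinarith
      -- Since `u ^ 2 = 1`, `(1 + u x) (u - x) = u (1 - x ^ 2)`: the logarithmic derivative of a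
      -- factor of the weight is the centered coordinate.
      have : (z i).1 k / 2 =
          (1 + (z i).1 k * x) / 2 * (((z i).1 k - x) / (1 - x ^ 2)) := by
        field_simp
        rcases signCube_eq_or (z i) k with h | h <;> rw [h] <;> ring
      rw [this]; ring
    rw [Finset.sum_congr rfl fun i _ => e i, ← Finset.mul_sum]
    simp only [hR]
    ring

theorem measurable_sampleExp {d n : ℕ} (F : (Fin n → signCube d) → ℝ) :
    Measurable fun p : Fin d → ℝ => sampleExp p F := by
  unfold sampleExp sampleWeight cubeWeight
  fun_prop

theorem measurable_sampleExp_centered {d n : ℕ} (F : (Fin n → signCube d) → ℝ) (k : Fin d) :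
    Measurable fun p : Fin d → ℝ => sampleExp p fun z => F z * ∑ i, centered p (z i).1 k := by
  unfold sampleExp sampleWeight cubeWeight centered
  fun_prop

theorem abs_sum_centered_le {d n : ℕ} {p : Fin d → ℝ} (hp : ∀ k, |p k| ≤ 5 / 8)
    (z : Fin n → signCube d) (k : Fin d) : |∑ i, centered p (z i).1 k| ≤ 4 * n :=
  (Finset.abs_sum_le_sum_abs _ _).trans
    ((Finset.sum_le_sum fun i _ => abs_centered_le hp (z i) k).trans (by simp [mul_comm]))

/-- With the other means frozen, the expectation of `F` is a polynomial in `p k` with values in `[0,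
1]` on `[-B, B]`, so the one-dimensional integration by parts applies. -/
theorem integral_fingerprint_ge {d n : ℕ} {lam B : ℝ} (hl : 0 < lam) (hB : 0 < B)
    (hB8 : B ≤ 5 / 8) (hBl : Real.exp (-(lam * B)) ≤ 1 / 2) (k : Fin d)
    {F : (Fin n → signCube d) → ℝ} (hF0 : ∀ z, 0 ≤ F z) (hF1 : ∀ z, F z ≤ 1) :
    Integrable (fun p => sampleExp p fun z => F z * ∑ i, centered p (z i).1 k)
      (Measure.pi fun _ : Fin d => laplacePrior lam B) ∧
    Integrable (fun p => leftSign (p k) * sampleExp p F)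
      (Measure.pi fun _ : Fin d => laplacePrior lam B) ∧
    -(lam * Real.exp (-(lam * B))) ≤
      ∫ p, (sampleExp p fun z => F z * ∑ i, centered p (z i).1 k)
        ∂(Measure.pi fun _ : Fin d => laplacePrior lam B) -
      lam * ∫ p, leftSign (p k) * sampleExp p F
        ∂(Measure.pi fun _ : Fin d => laplacePrior lam B) := by
  have hν := isProbabilityMeasure_laplacePrior hl hB
  set Q := Measure.pi fun _ : Fin d => laplacePrior lam B with hQ
  have hF : ∀ z, |F z| ≤ 1 := fun z => by rw [abs_of_nonneg (hF0 z)]; exact hF1 z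
  have hae : ∀ᵐ p ∂Q, ∀ k, |p k| ≤ B := ae_pi_abs_le (ae_laplacePrior_abs_le lam B)
  have hS : Integrable (fun p => sampleExp p fun z => F z * ∑ i, centered p (z i).1 k) Q := by
    refine Integrable.of_bound (measurable_sampleExp_centered F k).aestronglyMeasurable (4 * n) ?_
    filter_upwards [hae] with p hp
    have hp' : ∀ k, |p k| ≤ 5 / 8 := fun k => (hp k).trans hB8
    refine abs_sampleExp_le hp' fun z => ?_
    rw [abs_mul]
    calc _ ≤ 1 * (4 * n : ℝ) := mul_le_mul (hF z) (abs_sum_centered_le hp' z k)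
          (abs_nonneg _) zero_le_one
      _ = _ := one_mul _
  have hJ : Integrable (fun p => leftSign (p k) * sampleExp p F) Q := by
    refine Integrable.of_bound ((measurable_leftSign.comp (measurable_pi_apply k)).mul
      (measurable_sampleExp F)).aestronglyMeasurable 1 ?_
    filter_upwards [hae] with p hp
    rw [Real.norm_eq_abs, abs_mul, abs_leftSign, one_mul]
    exact abs_sampleExp_le (fun k => (hp k).trans hB8) hF
  refine ⟨hS, hJ, ?_⟩
  rw [← integral_const_mul, ← integral_sub hS (hJ.const_mul lam)]
  refine le_integral_pi_of_update k (hS.sub (hJ.const_mul lam)) ?_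
  filter_upwards [hae] with p hp
  obtain ⟨g', hg'c, hg', hg'e⟩ := exists_deriv_sampleExp p k F
  have hup : ∀ x, |x| ≤ B → ∀ j, |Function.update p k x j| ≤ 5 / 8 := fun x hx j => by
    by_cases hj : j = k
    · subst hj; rw [Function.update_self]; exact hx.trans hB8
    · rw [Function.update_of_ne hj]; exact (hp j).trans hB8
  have h0 : 0 ≤ sampleExp (Function.update p k B) F := by
    rw [← sampleExp_const n (Function.update p k B) 0]
    exact sampleExp_mono (hup B (by rw [abs_of_pos hB])) hF0
  have h1 : sampleExp (Function.update p k (-B)) F ≤ 1 := by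
    rw [← sampleExp_const n (Function.update p k (-B)) 1]
    exact sampleExp_mono (hup (-B) (by rw [abs_neg, abs_of_pos hB])) hF1
  refine (integral_deriv_sub_leftSign_ge hl hB hBl hg' hg'c h0 h1).trans (le_of_eq ?_)
  refine integral_congr_ae ?_
  filter_upwards [ae_laplacePrior_abs_le lam B] with x hx
  simp only [Pi.sub_apply, Function.update_self]
  rw [hg'e x (hx.trans hB8)]

open Classical in
theorem exists_totalScore_ge {d n h : ℕ} {lam B t : ℝ} (hl : 0 < lam) (hB : 0 < B)
    (hB8 : B ≤ 5 / 8) (hBl : Real.exp (-(lam * B)) ≤ 1 / 2)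
    (A : Kernel (Fin n → signCube d) (Fin d → ℝ)) [IsMarkovKernel A]
    (H : (Fin d → ℝ) → Finset (Fin d))
    (hV : ∀ p : Fin d → ℝ, (∀ k, |p k| ≤ B) →
      -((h : ℝ) / 4) ≤ ∑ k, leftSign (p k) * sampleExp p (fun z => (A z).real {θ | k ∈ H θ}))
    (hV' : ∀ p : Fin d → ℝ, (∀ k, |p k| ≤ B) → h ≤ (Finset.univ.filter fun k => t ≤ p k).card →
      (h : ℝ) / 2 ≤ ∑ k, leftSign (p k) * sampleExp p (fun z => (A z).real {θ | k ∈ H θ}))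
    (hQ : (Measure.pi fun _ : Fin d => laplacePrior lam B).real
      {p | (Finset.univ.filter fun k => t ≤ p k).card < h} ≤ 1 / 4) :
    ∃ p : Fin d → ℝ, (∀ k, |p k| ≤ B) ∧
      lam * ((h : ℝ) / 4 - d * Real.exp (-(lam * B))) ≤ totalScore A H p := by
  have hν := isProbabilityMeasure_laplacePrior hl hB
  set Q := Measure.pi fun _ : Fin d => laplacePrior lam B with hQdef
  have hae : ∀ᵐ p ∂Q, ∀ k, |p k| ≤ B := ae_pi_abs_le (ae_laplacePrior_abs_le lam B)
  have hF := fun k => integral_fingerprint_ge (n := n) hl hB hB8 hBl k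
    (F := fun z => (A z).real {θ | k ∈ H θ}) (fun z => measureReal_nonneg)
    (fun z => measureReal_le_one)
  have hSi : Integrable (totalScore A H) Q := integrable_finsetSum _ fun k _ => (hF k).1
  set V : (Fin d → ℝ) → ℝ := fun p =>
    ∑ k, leftSign (p k) * sampleExp p (fun z => (A z).real {θ | k ∈ H θ}) with hVdef
  have hVi : Integrable V Q := integrable_finsetSum _ fun k _ => (hF k).2.1
  set S := {p : Fin d → ℝ | (Finset.univ.filter fun k => t ≤ p k).card < h} with hS
  have hms : MeasurableSet S := by
    have hN : Measurable fun p : Fin d → ℝ => (Finset.univ.filter fun k => t ≤ p k).card := by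
      simp only [Finset.card_filter]
      exact Finset.measurable_sum _ fun k _ => Measurable.ite
        (measurableSet_le measurable_const (measurable_pi_apply k)) measurable_const
        measurable_const
    exact measurableSet_lt hN measurable_const
  have hSind : Integrable (S.indicator (1 : (Fin d → ℝ) → ℝ)) Q :=
    (integrable_const (1 : ℝ)).indicator hms
  have hVge : (h : ℝ) / 4 ≤ ∫ p, V p ∂Q := by
    -- Both hypotheses on `V` are merged into one bound; as `S` has mass at most `1 / 4`, its
    -- integral is at least `5 h / 16`.
    have h1 : ∫ p, ((h : ℝ) / 2 - 3 * h / 4 * S.indicator (1 : (Fin d → ℝ) → ℝ) p) ∂Q ≤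
        ∫ p, V p ∂Q := by
      refine integral_mono_ae ((integrable_const _).sub (hSind.const_mul _)) hVi ?_
      filter_upwards [hae] with p hp
      by_cases hpS : p ∈ S
      · rw [Set.indicator_of_mem hpS, Pi.one_apply]
        have := hV p hp
        linarith
      · rw [Set.indicator_of_notMem hpS]
        have := hV' p hp (not_lt.1 hpS)
        linarith
    rw [integral_sub (integrable_const _) (hSind.const_mul _), integral_const_mul,
      integral_indicator_one hms] at h1
    simp only [integral_const, probReal_univ, smul_eq_mul, one_mul] at h1
    have h0 : (0 : ℝ) ≤ h := Nat.cast_nonneg h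
    nlinarith
  have hT : lam * ((h : ℝ) / 4 - d * Real.exp (-(lam * B))) ≤ ∫ p, totalScore A H p ∂Q := by
    have e1 : ∫ p, totalScore A H p ∂Q = ∑ k, ∫ p, (sampleExp p fun z : Fin n → signCube d =>
        (A z).real {θ | k ∈ H θ} * ∑ i, centered p (z i).1 k) ∂Q :=
      integral_finsetSum _ fun k _ => (hF k).1
    have e2 : ∫ p, V p ∂Q = ∑ k, ∫ p, leftSign (p k) *
        sampleExp p (fun z => (A z).real {θ | k ∈ H θ}) ∂Q :=
      integral_finsetSum _ fun k _ => (hF k).2.1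
    have h1 := Finset.sum_le_sum fun k (_ : k ∈ Finset.univ) => (hF k).2.2
    rw [Finset.sum_sub_distrib, ← Finset.mul_sum, ← e1, ← e2] at h1
    simp only [Finset.sum_const, Finset.card_univ, Fintype.card_fin, nsmul_eq_mul] at h1
    nlinarith
  obtain ⟨p, hpN, hp⟩ := exists_notMem_null_integral_le hSi (ae_iff.1 hae)
  simp only [not_not, Set.mem_ofPred_eq] at hpN
  exact ⟨p, hpN, hT.trans hp⟩

/-! ### Selecting large coordinates -/

open Classical in
-- The choice depends on `θ` only through the finite set of coordinates at least `t`, so any choice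
-- function is measurable. An exact size is imposed so that the score has one fixed variance proxy.
theorem exists_selection (d h : ℕ) (t : ℝ) : ∃ H : (Fin d → ℝ) → Finset (Fin d),
    (∀ k, MeasurableSet {θ | k ∈ H θ}) ∧ (∀ θ, (H θ).card = h ∨ H θ = ∅) ∧
    (∀ θ, ∀ k ∈ H θ, t ≤ θ k) ∧
    ∀ θ, h ≤ (Finset.univ.filter fun k => t ≤ θ k).card → (H θ).card = h := by
  have hsel : ∀ s : Finset (Fin d), ∃ u ⊆ s, (u.card = h ∨ u = ∅) ∧
      (h ≤ s.card → u.card = h) := fun s => by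
    by_cases hs : h ≤ s.card
    · obtain ⟨u, hu, huc⟩ := Finset.exists_subset_card_eq hs
      exact ⟨u, hu, Or.inl huc, fun _ => huc⟩
    · exact ⟨∅, Finset.empty_subset _, Or.inr rfl, fun h' => absurd h' hs⟩
  choose sel hsub hcard hfull using hsel
  set Tset : (Fin d → ℝ) → Finset (Fin d) := fun θ => Finset.univ.filter fun k => t ≤ θ k
  have hT : ∀ s, MeasurableSet {θ | Tset θ = s} := fun s => by
    have : {θ : Fin d → ℝ | Tset θ = s} = ⋂ k, {θ | t ≤ θ k ↔ k ∈ s} := by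
      ext θ
      simp [Tset, Finset.ext_iff]
    rw [this]
    refine MeasurableSet.iInter fun k => ?_
    have hk : MeasurableSet {θ : Fin d → ℝ | t ≤ θ k} :=
      measurableSet_le measurable_const (measurable_pi_apply k)
    by_cases hks : k ∈ s
    · simpa [hks] using hk
    · simpa [hks] using measurableSet_lt (measurable_pi_apply k) measurable_const
  refine ⟨fun θ => sel (Tset θ), fun k => ?_, fun θ => hcard _, fun θ k hk => ?_,
    fun θ hθ => hfull _ hθ⟩
  · have : {θ | k ∈ sel (Tset θ)} = ⋃ s ∈ {s | k ∈ sel s}, {θ | Tset θ = s} := by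
      ext θ; simp
    rw [this]
    exact MeasurableSet.biUnion (Set.to_countable _) fun s _ => hT s
  · simpa [Tset] using hsub _ hk

/-! ### Consequences of accuracy -/

/-- Markov's inequality: the mean error `α / 2` is a quarter of `2 * α`. -/
theorem sampleExp_error_le {d n : ℕ} {p : Fin d → ℝ} (hp : ∀ k, |p k| ≤ 5 / 8)
    (A : Kernel (Fin n → signCube d) (Fin d → ℝ)) [IsMarkovKernel A] {α : ℝ} (hα : 0 < α)
    (hA : IsMeanEstimator A (α / 2)) :
    sampleExp p (fun z => (A z).real {θ | 2 * α ≤ ‖θ - p‖}) ≤ 1 / 4 := by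
  have hD := isProbabilityMeasure_cubeLaw hp
  have h := hA (cubeLaw p) hD
  rw [cubeMean_cubeLaw hp, lintegral_trainLaw hp A (by fun_prop)] at h
  have h1 : ∀ z, ENNReal.ofReal (2 * α * (A z).real {θ | 2 * α ≤ ‖θ - p‖}) ≤
      ∫⁻ θ, ‖θ - p‖ₑ ∂(A z) := fun z => by
    have hm := mul_meas_ge_le_lintegral (μ := A z) (f := fun θ => ‖θ - p‖ₑ) (by fun_prop)
      (ENNReal.ofReal (2 * α))
    rw [ENNReal.ofReal_mul (by positivity), ofReal_measureReal]
    refine le_trans (le_of_eq ?_) hm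
    congr 2
    ext θ
    simp only [Set.mem_ofPred_eq]
    rw [← ofReal_norm, ENNReal.ofReal_le_ofReal_iff (norm_nonneg _)]
  have h2 : ENNReal.ofReal (∑ z, sampleWeight p z *
      (2 * α * (A z).real {θ | 2 * α ≤ ‖θ - p‖})) ≤ ENNReal.ofReal (α / 2) := by
    refine le_trans ?_ h
    rw [ENNReal.ofReal_sum_of_nonneg fun z _ =>
      mul_nonneg (sampleWeight_nonneg hp z) (by positivity)]
    refine Finset.sum_le_sum fun z _ => ?_
    rw [ENNReal.ofReal_mul (sampleWeight_nonneg hp z)]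
    gcongr
    exact h1 z
  rw [ENNReal.ofReal_le_ofReal_iff (by positivity)] at h2
  have h3 : ∑ z, sampleWeight p z * (2 * α * (A z).real {θ | 2 * α ≤ ‖θ - p‖}) =
      2 * α * sampleExp p (fun z => (A z).real {θ | 2 * α ≤ ‖θ - p‖}) := by
    rw [sampleExp, Finset.mul_sum]
    exact Finset.sum_congr rfl fun z _ => by ring
  rw [h3] at h2
  nlinarith

/-- On an accurate output the signs sum to the size of `H θ`, hence to at least `c`; otherwise they
sum to at least `-h`, with probability at most `1 / 4`. It serves with `c = 0` for every `p`, and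
with `c = h` when many means are large. -/
theorem sum_leftSign_ge {d n h : ℕ} {p : Fin d → ℝ} (hp : ∀ k, |p k| ≤ 5 / 8)
    (A : Kernel (Fin n → signCube d) (Fin d → ℝ)) [IsMarkovKernel A]
    {H : (Fin d → ℝ) → Finset (Fin d)} (hHm : ∀ k, MeasurableSet {θ | k ∈ H θ})
    (hH : ∀ θ, (H θ).card ≤ h) {τ c : ℝ} (hc : 0 ≤ c)
    (hpos : ∀ θ, ‖θ - p‖ < τ → ∀ k ∈ H θ, 0 < p k)
    (hcard : ∀ θ, ‖θ - p‖ < τ → c ≤ (H θ).card)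
    (herr : sampleExp p (fun z => (A z).real {θ | τ ≤ ‖θ - p‖}) ≤ 1 / 4) :
    c - (c + h) / 4 ≤
      ∑ k, leftSign (p k) * sampleExp p (fun z => (A z).real {θ | k ∈ H θ}) := by
  have hbm : MeasurableSet {θ : Fin d → ℝ | τ ≤ ‖θ - p‖} :=
    measurableSet_le measurable_const (by fun_prop)
  have h1 : ∀ z, c - (c + h) * (A z).real {θ | τ ≤ ‖θ - p‖} ≤
      ∑ k, (A z).real {θ | k ∈ H θ} * leftSign (p k) := fun z => by
    obtain ⟨hi, hI⟩ := integral_sum_mem hHm (A z) (fun k => leftSign (p k))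
    have hind : Integrable ({θ : Fin d → ℝ | τ ≤ ‖θ - p‖}.indicator (1 : (Fin d → ℝ) → ℝ)) (A z) :=
      (integrable_const (1 : ℝ)).indicator hbm
    have e : c - (c + h) * (A z).real {θ | τ ≤ ‖θ - p‖} = ∫ θ, (c - (c + h) *
        {θ : Fin d → ℝ | τ ≤ ‖θ - p‖}.indicator (1 : (Fin d → ℝ) → ℝ) θ) ∂(A z) := by
      rw [integral_sub (integrable_const _) (hind.const_mul _), integral_const_mul,
        integral_indicator_one hbm]
      simp
    rw [e, ← hI]
    refine integral_mono ((integrable_const _).sub (hind.const_mul _)) hi fun θ => ?_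
    simp only
    by_cases hθ : τ ≤ ‖θ - p‖
    · rw [Set.indicator_of_mem (s := {θ : Fin d → ℝ | τ ≤ ‖θ - p‖}) hθ, Pi.one_apply]
      have h2 : -((H θ).card : ℝ) ≤ ∑ k ∈ H θ, leftSign (p k) := by
        calc -((H θ).card : ℝ) = ∑ k ∈ H θ, (-1 : ℝ) := by simp
          _ ≤ _ := Finset.sum_le_sum fun k _ => (abs_le.1 (abs_leftSign (p k)).le).1
      have h3 : ((H θ).card : ℝ) ≤ h := by exact_mod_cast hH θ
      linarith
    · rw [Set.indicator_of_notMem (s := {θ : Fin d → ℝ | τ ≤ ‖θ - p‖}) hθ]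
      have h2 : ∑ k ∈ H θ, leftSign (p k) = (H θ).card := by
        have h3 : ∀ k ∈ H θ, leftSign (p k) = 1 := fun k hk => if_pos (hpos θ (not_le.1 hθ) k hk)
        rw [Finset.sum_congr rfl h3]
        simp
      have := hcard θ (not_le.1 hθ)
      linarith
  have h2 : ∑ k, leftSign (p k) * sampleExp p (fun z => (A z).real {θ | k ∈ H θ}) =
      sampleExp p fun z => ∑ k, (A z).real {θ | k ∈ H θ} * leftSign (p k) := by
    simp only [sampleExp, Finset.mul_sum]
    rw [Finset.sum_comm]
    exact Finset.sum_congr rfl fun z _ => Finset.sum_congr rfl fun k _ => by ring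
  rw [h2]
  refine le_trans ?_ (sampleExp_mono hp h1)
  have h3 : sampleExp p (fun z => c - (c + h) * (A z).real {θ | τ ≤ ‖θ - p‖}) =
      c - (c + h) * sampleExp p (fun z => (A z).real {θ | τ ≤ ‖θ - p‖}) := by
    conv_rhs => rw [← sampleExp_const n p c]
    simp only [sampleExp, Finset.mul_sum]
    rw [← Finset.sum_sub_distrib]
    exact Finset.sum_congr rfl fun z _ => by
      rw [← Finset.sum_mul, sum_sampleWeight]; ring
  rw [h3]
  have : (0 : ℝ) ≤ c + h := by positivity
  nlinarith

open Classical in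
/-- An accurate estimator has a large total score for some mean vector. -/
theorem exists_totalScore_ge_of_isMeanEstimator {d n h : ℕ} {α lam : ℝ} (hα : 0 < α)
    (hα8 : α ≤ 1 / 8) (hl : 0 < lam) (hBl : Real.exp (-(lam * (5 * α))) ≤ 1 / 2)
    (A : Kernel (Fin n → signCube d) (Fin d → ℝ)) [IsMarkovKernel A]
    (hA : IsMeanEstimator A (α / 2)) {H : (Fin d → ℝ) → Finset (Fin d)}
    (hHm : ∀ k, MeasurableSet {θ | k ∈ H θ}) (hH : ∀ θ, (H θ).card = h ∨ H θ = ∅)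
    (hHt : ∀ θ, ∀ k ∈ H θ, 2 * α ≤ θ k)
    (hHf : ∀ θ, h ≤ (Finset.univ.filter fun k => 2 * α ≤ θ k).card → (H θ).card = h)
    (hq : Real.exp (h - d * ((Real.exp (-(lam * (4 * α))) - Real.exp (-(lam * (5 * α)))) / 2) / 2)
      ≤ 1 / 4) :
    ∃ p : Fin d → ℝ, (∀ k, |p k| ≤ 5 / 8) ∧
      lam * ((h : ℝ) / 4 - d * Real.exp (-(lam * (5 * α)))) ≤ totalScore A H p := by
  have hB : 0 < 5 * α := by positivity
  have hB8 : 5 * α ≤ 5 / 8 := by linarith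
  have hν := isProbabilityMeasure_laplacePrior hl hB
  have hle : ∀ θ, (H θ).card ≤ h := fun θ => by
    rcases hH θ with h | h <;> simp [h]
  have hclose : ∀ p θ : Fin d → ℝ, ‖θ - p‖ < 2 * α → ∀ k, |θ k - p k| < 2 * α :=
    fun p θ hθ k => (norm_le_pi_norm (θ - p) k).trans_lt hθ
  -- With error below `2 * α`, an output at least `2 * α` forces a positive mean, and a mean at
  -- least `4 * α` forces an output above `2 * α`.
  have hpos : ∀ p θ : Fin d → ℝ, ‖θ - p‖ < 2 * α → ∀ k ∈ H θ, 0 < p k := fun p θ hθ k hk => by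
    have := abs_lt.1 (hclose p θ hθ k)
    linarith [hHt θ k hk]
  refine Exists.imp (fun p hp => ⟨fun k => (hp.1 k).trans hB8, hp.2⟩)
    (exists_totalScore_ge (t := 4 * α) hl hB hB8 hBl A H (h := h)
      (fun p hp => ?_) (fun p hp hcard => ?_) ?_)
  · have hp8 : ∀ k, |p k| ≤ 5 / 8 := fun k => (hp k).trans hB8
    have := sum_leftSign_ge hp8 A hHm hle le_rfl (hpos p) (fun θ _ => Nat.cast_nonneg _)
      (sampleExp_error_le hp8 A hα hA)
    linarith
  · have hp8 : ∀ k, |p k| ≤ 5 / 8 := fun k => (hp k).trans hB8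
    have := sum_leftSign_ge hp8 A hHm hle (Nat.cast_nonneg h) (hpos p) (fun θ hθ => ?_)
      (sampleExp_error_le hp8 A hα hA)
    · linarith
    · rw [hHf θ (hcard.trans (Finset.card_le_card fun k hk => ?_))]
      simp only [Finset.mem_filter, Finset.mem_univ, true_and] at hk ⊢
      have := abs_lt.1 (hclose p θ hθ k)
      linarith
  · refine (pi_card_lt_le (laplacePrior lam (5 * α)) (4 * α) h).trans (le_trans ?_ hq)
    have := laplacePrior_Ici_ge (t := 4 * α) hl hB (by positivity) (by linarith)
    gcongr

/-! ### From scores to traceability -/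

/-- The fresh point is independent of the output, so soundness is checked with `H θ` fixed. -/
theorem isTraceable_of_tracedCount {d n h m : ℕ} {p : Fin d → ℝ} (hp : ∀ k, |p k| ≤ 5 / 8)
    (A : Kernel (Fin n → signCube d) (Fin d → ℝ)) [IsMarkovKernel A]
    {H : (Fin d → ℝ) → Finset (Fin d)} (hHm : ∀ k, MeasurableSet {θ | k ∈ H θ})
    (hH : ∀ θ, (H θ).card = h ∨ H θ = ∅) (hh : 0 < h) {ξ T : ℝ} (hξ : 0 < ξ) (hT : 0 < T)
    (hT2 : T ^ 2 = 32 * h * Real.log (1 / ξ))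
    (hm : (m : ℝ) ≤ ∑ z, sampleWeight p z * ∫ θ, (tracedCount p T z (H θ) : ℝ) ∂(A z)) :
    IsTraceable A ξ m := by
  classical
  have hD := isProbabilityMeasure_cubeLaw hp
  have hTL := isProbabilityMeasure_trainLaw A (cubeLaw p)
  have hφ : Measurable (Function.uncurry fun (θ : Fin d → ℝ) (u : signCube d) =>
      ∑ k ∈ H θ, centered p u.1 k) := by
    refine measurable_from_prod_countable_left fun u => ?_
    have : (fun θ => ∑ k ∈ H θ, centered p u.1 k) =
        fun θ => ∑ k, if k ∈ H θ then centered p u.1 k else 0 := by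
      ext θ; rw [Finset.sum_ite_mem, Finset.univ_inter]
    change Measurable fun θ => ∑ k ∈ H θ, centered p u.1 k
    rw [this]
    exact Finset.measurable_sum _ fun k _ => Measurable.ite (hHm k) measurable_const
      measurable_const
  refine ⟨fun θ u => ∑ k ∈ H θ, centered p u.1 k, hφ, cubeLaw p, hD, T, ?_, ?_⟩
  · have hms : MeasurableSet {ω : ((Fin n → signCube d) × (Fin d → ℝ)) × signCube d |
        T ≤ ∑ k ∈ H ω.1.2, centered p ω.2.1 k} :=
      measurableSet_le measurable_const
        (hφ.comp ((measurable_snd.comp measurable_fst).prodMk measurable_snd))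
    rw [Measure.prod_apply hms]
    calc _ ≤ ∫⁻ _, ENNReal.ofReal ξ ∂(trainLaw A (cubeLaw p)) :=
          lintegral_mono fun ω => cubeLaw_score_ge_le hp (hH ω.2) hh hξ hT hT2
      _ = ENNReal.ofReal ξ := by simp
  · have hNm : Measurable fun ω : (Fin n → signCube d) × (Fin d → ℝ) =>
        ((({i : Fin n | T ≤ ∑ k ∈ H ω.2, centered p (ω.1 i).1 k} : Set (Fin n)).ncard : ℕ) :
          ℝ≥0∞) := by
      refine measurable_from_prod_countable_right fun z => ?_
      have h1 := (measurable_tracedCount hHm p T z).ennreal_ofReal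
      simp only [ENNReal.ofReal_natCast] at h1
      exact h1
    rw [lintegral_trainLaw hp A hNm]
    have h2 : ∀ z : Fin n → signCube d,
        ∫⁻ θ, ((({i : Fin n | T ≤ ∑ k ∈ H θ, centered p (z i).1 k} : Set (Fin n)).ncard : ℕ) :
          ℝ≥0∞) ∂(A z) = ENNReal.ofReal (∫ θ, (tracedCount p T z (H θ) : ℝ) ∂(A z)) := fun z => by
      rw [ofReal_integral_eq_lintegral_ofReal (integrable_tracedCount hHm p T z (A z))
        (Filter.Eventually.of_forall fun θ => Nat.cast_nonneg _)]
      simp only [ENNReal.ofReal_natCast]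
      rfl
    have hnn : ∀ z : Fin n → signCube d, 0 ≤ ∫ θ, (tracedCount p T z (H θ) : ℝ) ∂(A z) :=
      fun z => integral_nonneg fun θ => Nat.cast_nonneg _
    simp only [h2]
    rw [← ENNReal.ofReal_natCast]
    refine (ENNReal.ofReal_le_ofReal hm).trans (le_of_eq ?_)
    rw [ENNReal.ofReal_sum_of_nonneg fun z _ => mul_nonneg (sampleWeight_nonneg hp z) (hnn z)]
    exact Finset.sum_congr rfl fun z _ => ENNReal.ofReal_mul (sampleWeight_nonneg hp z)

/-! ### Parameters -/

theorem eventually_large_dimension : ∃ d₀ : ℕ, ∀ d : ℕ, d₀ ≤ d → 1 ≤ d ∧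
    (10 : ℝ) ^ 13 ≤ (d : ℝ) ^ (0.016 : ℝ) ∧ 256 ≤ (d : ℝ) ^ (0.001 : ℝ) ∧
    (10 : ℝ) ^ 13 ≤ Real.log d ∧ (10 : ℝ) ^ 6 ≤ (d : ℝ) := by
  have h0 := tendsto_natCast_atTop_atTop (R := ℝ)
  have h1 := ((tendsto_rpow_atTop (show (0 : ℝ) < 0.016 by norm_num)).comp h0).eventually_ge_atTop
    ((10 : ℝ) ^ 13)
  have h2 := ((tendsto_rpow_atTop (show (0 : ℝ) < 0.001 by norm_num)).comp h0).eventually_ge_atTop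
    256
  have h3 := (Real.tendsto_log_atTop.comp h0).eventually_ge_atTop ((10 : ℝ) ^ 13)
  have h4 := h0.eventually_ge_atTop ((10 : ℝ) ^ 6)
  exact Filter.eventually_atTop.1 (by
    filter_upwards [Filter.eventually_ge_atTop 1, h1, h2, h3, h4] with d a b c e f
    exact ⟨a, b, c, e, f⟩)

/-- The admissible range of `α`, in multiplied-out form. -/
theorem accuracy_range {d n : ℕ} {α L X l : ℝ} (hn : 1 ≤ n) (hα : 0 < α)
    (hL : 1 ≤ L) (hl : 1 ≤ l) (hXd : X ^ 2 ≤ d) (h1 : 1 * Real.sqrt (L / n) ≤ α)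
    (h2 : α ≤ 1 * (X / (n * Real.sqrt l))) :
    n * Real.sqrt l ≤ X / α ∧ L / α ≤ X ∧ n ≤ d := by
  have hn0 : (0 : ℝ) < n := by exact_mod_cast hn
  have hl1 : 1 ≤ Real.sqrt l := Real.one_le_sqrt.2 hl
  rw [one_mul] at h1 h2
  rw [le_div_iff₀ (by positivity)] at h2
  have ha : n * Real.sqrt l ≤ X / α := by rw [le_div_iff₀ hα]; linarith
  have hna : n * α ≤ X := by
    have : n * α * 1 ≤ n * α * Real.sqrt l := by gcongr
    linarith
  have hb : L ≤ n * α ^ 2 := by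
    have := (Real.sqrt_le_left hα.le).1 h1
    rw [div_le_iff₀ hn0] at this
    linarith
  refine ⟨ha, ?_, ?_⟩
  · rw [div_le_iff₀ hα]
    nlinarith
  · have h3 : (n : ℝ) * 1 ≤ n * L := by gcongr
    have h4 : (n : ℝ) * L ≤ (n * α) ^ 2 := by nlinarith
    have h5 : (n * α) ^ 2 ≤ X ^ 2 := by gcongr
    have : (n : ℝ) ≤ d := by linarith
    exact_mod_cast this

/-- The target is `h * K / 8000` with `K = L / α`. The first two terms together, the third and the
fourth are each at most `h * K / 64000`; hence `448000 = 7 * 64000` and `512000 = 8 * 64000`. -/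
theorem score_bounds_separated {d n h : ℕ} {α L X l M T : ℝ} (hd : (10 : ℝ) ^ 6 ≤ d)
    (hh : 0 < h) (hα : 0 < α) (hα8 : α ≤ 1 / 8) (hL : 1 ≤ L) (hX : 0 ≤ X)
    (ha : n * Real.sqrt l ≤ X / α) (hK : L / α ≤ X) (hXh : 448000 * X ≤ Real.sqrt h)
    (hM : M = (1 / 512000) ^ 2 * L / α ^ 2) (hT : T = Real.sqrt (32 * h) * Real.sqrt l) :
    n * T + 8 * Real.sqrt L * (Real.sqrt h * M + h * Real.sqrt M) + 36 * h / d <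
      1 / 1000 * L / α * (h / 8) := by
  have hd0 : (0 : ℝ) < d := lt_of_lt_of_le (by norm_num) hd
  have hh0 : (0 : ℝ) < h := by exact_mod_cast hh
  set r := Real.sqrt h with hr
  have hr0 : 0 < r := Real.sqrt_pos.2 hh0
  have hr2 : (h : ℝ) = r * r := (Real.mul_self_sqrt hh0.le).symm
  set s := Real.sqrt L with hs
  have hs1 : 1 ≤ s := Real.one_le_sqrt.2 hL
  have hs2 : L = s * s := (Real.mul_self_sqrt (by linarith)).symm
  have hsM : Real.sqrt M = 1 / 512000 * s / α := by
    rw [hM, show (1 / 512000 : ℝ) ^ 2 * L / α ^ 2 = (1 / 512000 * s / α) ^ 2 by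
      rw [hs2]; ring, Real.sqrt_sq (by positivity)]
  have hTle : T ≤ 6 * r * Real.sqrt l := by
    rw [hT, Real.sqrt_mul (by norm_num)]
    have : Real.sqrt 32 ≤ 6 := by
      rw [Real.sqrt_le_left (by norm_num)]; norm_num
    gcongr
  set K := L / α with hKdef
  have hK8 : 8 ≤ K := by
    rw [hKdef, le_div_iff₀ hα]; linarith
  have ht1 : n * T ≤ 6 * (r * (K * X)) := by
    have h1 : n * T ≤ 6 * r * (n * Real.sqrt l) := by
      calc n * T ≤ n * (6 * r * Real.sqrt l) := by gcongr
        _ = _ := by ring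
    have h2 : 6 * r * (n * Real.sqrt l) ≤ 6 * r * (X / α) := by gcongr
    have h3 : X / α ≤ K * X := by
      rw [hKdef, div_mul_eq_mul_div]
      gcongr
      nlinarith
    have h4 : 6 * r * (X / α) ≤ 6 * r * (K * X) := by gcongr
    linarith
  have ht2 : 8 * s * (r * M) ≤ r * (K * X) := by
    have e : 8 * s * (r * M) = 8 * (1 / 512000) ^ 2 * (r * (K * (s / α))) := by
      rw [hM, hKdef]; field_simp
    have h1 : s / α ≤ X := le_trans (by rw [hKdef]; gcongr; nlinarith) hK
    have h2 : r * (K * (s / α)) ≤ r * (K * X) := by gcongr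
    have h3 : 0 ≤ r * (K * X) := by positivity
    rw [e]
    linarith
  have ht3 : 8 * s * (h * Real.sqrt M) = 8 / 512000 * (h * K) := by
    rw [hsM, hKdef, hs2]; ring
  have ht4 : 36 * h / d ≤ 1 / 64000 * (h * K) := by
    rw [div_le_iff₀ hd0]
    have h1 : (8 : ℝ) * 10 ^ 6 ≤ K * d := by gcongr
    have h2 : (h : ℝ) * (8 * 10 ^ 6) ≤ h * (K * d) := by gcongr
    linarith
  have ht5 : 7 * (r * (K * X)) ≤ 1 / 64000 * (h * K) := by
    have : r * K * (448000 * X) ≤ r * K * r := by gcongr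
    rw [hr2]
    linarith
  have hhK : 0 < h * K := by positivity
  have e : 1 / 1000 * L / α * (h / 8) = 1 / 8000 * (h * K) := by rw [hKdef]; ring
  rw [e, mul_add, ht3]
  linarith

/-- The choice is `h = ⌊d^0.996 / 16⌋`. Since `0.996 > 0.98`, `√h` beats `d^0.49`; since `0.996 >
0.995`, `h` absorbs the boundary terms; the factor `1 / 16` keeps `h` below the typical number of
large means. -/
theorem exists_selection_size {d : ℕ} (hd1 : (1 : ℝ) ≤ d)
    (hd16 : (10 : ℝ) ^ 13 ≤ (d : ℝ) ^ (0.016 : ℝ)) (hd256 : 256 ≤ (d : ℝ) ^ (0.001 : ℝ)) :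
    ∃ h : ℕ, 0 < h ∧ 448000 * (d : ℝ) ^ (0.49 : ℝ) ≤ Real.sqrt h ∧
      d * (d : ℝ) ^ (-0.005 : ℝ) ≤ h / 8 ∧ (d : ℝ) ^ (-0.005 : ℝ) ≤ 1 / 2 ∧
      (h : ℝ) - d * (((d : ℝ) ^ (-0.004 : ℝ) - (d : ℝ) ^ (-0.005 : ℝ)) / 2) / 2 ≤ -2 := by
  have hdpos : (0 : ℝ) < d := by linarith
  set X := (d : ℝ) ^ (0.49 : ℝ) with hXdef
  have hX2 : X ^ 2 = (d : ℝ) ^ (0.98 : ℝ) := by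
    rw [hXdef, ← Real.rpow_natCast, ← Real.rpow_mul hdpos.le]; norm_num
  set Y : ℝ := (d : ℝ) ^ (0.996 : ℝ) / 16 with hY
  have hP : (10 : ℝ) ^ 13 * X ^ 2 ≤ 16 * Y := by
    rw [hX2, hY, mul_div_cancel₀ _ (by norm_num),
      show (0.996 : ℝ) = 0.016 + 0.98 by norm_num, Real.rpow_add hdpos]
    gcongr
  have hX1 : 1 ≤ X := Real.one_le_rpow hd1 (by norm_num)
  have hY2 : 2 ≤ Y := by nlinarith
  obtain ⟨h, hh⟩ : ∃ h : ℕ, h = ⌊Y⌋₊ := ⟨_, rfl⟩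
  have hhY : (h : ℝ) ≤ Y := by
    rw [hh]; exact Nat.floor_le (by linarith)
  have hYh : Y / 2 ≤ h := by
    have := Nat.lt_floor_add_one Y
    rw [← hh] at this
    linarith
  have hh0 : 0 < h := by
    have : (0 : ℝ) < h := by linarith
    exact_mod_cast this
  have hXh : 448000 * X ≤ Real.sqrt h := by
    apply Real.le_sqrt_of_sq_le
    nlinarith
  have hd4 : (d : ℝ) * (d : ℝ) ^ (-0.004 : ℝ) = 16 * Y := by
    rw [hY, show (0.996 : ℝ) = 1 + -0.004 by norm_num, Real.rpow_add hdpos, Real.rpow_one]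
    ring
  have h45 : (d : ℝ) ^ (-0.004 : ℝ) = (d : ℝ) ^ (0.001 : ℝ) * (d : ℝ) ^ (-0.005 : ℝ) := by
    rw [← Real.rpow_add hdpos]; norm_num
  have h45' : 256 * (d : ℝ) ^ (-0.005 : ℝ) ≤ (d : ℝ) ^ (-0.004 : ℝ) := by
    rw [h45]; gcongr
  have h4le : (d : ℝ) ^ (-0.004 : ℝ) ≤ 1 :=
    Real.rpow_le_one_of_one_le_of_nonpos hd1 (by norm_num)
  have hd5 : 256 * (d * (d : ℝ) ^ (-0.005 : ℝ)) ≤ 16 * Y := by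
    rw [← hd4]
    calc 256 * (d * (d : ℝ) ^ (-0.005 : ℝ)) = d * (256 * (d : ℝ) ^ (-0.005 : ℝ)) := by ring
      _ ≤ _ := by gcongr
  refine ⟨h, hh0, hXh, ?_, ?_, ?_⟩ <;> linarith

/-- Halving the constant leaves room for rounding: the halved quantity is at least `1`, so its
ceiling is at most twice it. -/
theorem ceil_recall_le {L α : ℝ} (hα : 0 < α) (hα8 : α ≤ 1 / 8) (hL : (10 : ℝ) ^ 13 ≤ L) :
    ((⌈(1 / 512000) ^ 2 / 2 * (L / α ^ 2)⌉₊ : ℕ) : ℝ) ≤ (1 / 512000) ^ 2 * L / α ^ 2 := by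
  have h0 : L ≤ L / α ^ 2 := by
    rw [le_div_iff₀ (by positivity)]
    have h1 : α ^ 2 ≤ 1 := by nlinarith
    exact mul_le_of_le_one_right (le_trans (by norm_num) hL) h1
  rw [mul_div_assoc]
  generalize L / α ^ 2 = R at *
  have h1 : 1 ≤ (1 / 512000 : ℝ) ^ 2 / 2 * R := by linarith
  have h2 := (Nat.ceil_lt_add_one (zero_le_one.trans h1)).le
  linarith

end

/-! ### Choice of constants and conclusion. -/

theorem mainTheorem9 :
    ∃ c : ℝ, 0 < c ∧ ∃ C : ℝ, 0 < C ∧ ∃ d₀ : ℕ,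
      ∀ (d n : ℕ) (ξ α : ℝ), d₀ ≤ d → 1 ≤ n → 0 < ξ → ξ < 1 / Real.exp 1 → 0 < α →
        c * Real.sqrt (Real.log d / n) ≤ α →
        α ≤ min (c * ((d : ℝ) ^ (0.49 : ℝ) / (n * Real.sqrt (Real.log (1 / ξ))))) (1 / 8) →
        ∀ A : Kernel (Fin n → signCube d) (Fin d → ℝ), IsMarkovKernel A →
          IsMeanEstimator A (α / 2) →
            ∃ m : ℕ, C * (Real.log d / α ^ 2) ≤ m ∧ IsTraceable A ξ m := by
  obtain ⟨d₀, hd₀⟩ := eventually_large_dimension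
  refine ⟨1, one_pos, (1 / 512000) ^ 2 / 2, by norm_num, d₀,
    fun d n ξ α hd hn hξ hξe hα hα1 hα2 A hAk hA => ?_⟩
  obtain ⟨hd1, hd16, hd256, hlog, hd6⟩ := hd₀ d hd
  obtain ⟨hα2, hα8⟩ := le_min_iff.1 hα2
  have hdpos : (0 : ℝ) < d := by exact_mod_cast hd1
  set L := Real.log d with hLdef
  set X := (d : ℝ) ^ (0.49 : ℝ) with hXdef
  have hX0 : 0 < X := by positivity
  have hL1 : 1 ≤ L := le_trans (by norm_num) hlog
  have hl : 1 ≤ Real.log (1 / ξ) := by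
    rw [Real.le_log_iff_exp_le (by positivity), le_div_iff₀ hξ]
    rw [lt_div_iff₀ (Real.exp_pos 1)] at hξe
    linarith
  have hX2 : X ^ 2 = (d : ℝ) ^ (0.98 : ℝ) := by
    rw [hXdef, ← Real.rpow_natCast, ← Real.rpow_mul hdpos.le]; norm_num
  have hd1' : (1 : ℝ) ≤ d := by exact_mod_cast hd1
  have hXd : X ^ 2 ≤ d := by
    rw [hX2]
    exact Real.rpow_le_self_of_one_le hd1' (by norm_num)
  obtain ⟨ha, hK, hnd⟩ := accuracy_range hn hα hL1 hl hXd hα1 hα2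
  -- the size of the selected set
  obtain ⟨h, hh0, hXh, hd5, hhalf, htail⟩ := exists_selection_size hd1' hd16 hd256
  -- At this rate the Laplace weights at `4 * α` and `5 * α` are `d^(-0.004)` and `d^(-0.005)`,
  -- whatever `α` is.
  set lam : ℝ := 1 / 1000 * L / α with hlam
  have hlam0 : 0 < lam := by positivity
  have e4 : Real.exp (-(lam * (4 * α))) = (d : ℝ) ^ (-0.004 : ℝ) := by
    rw [Real.rpow_def_of_pos hdpos, ← hLdef, hlam]
    congr 1; field_simp; norm_num
  have e5 : Real.exp (-(lam * (5 * α))) = (d : ℝ) ^ (-0.005 : ℝ) := by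
    rw [Real.rpow_def_of_pos hdpos, ← hLdef, hlam]
    congr 1; field_simp; norm_num
  obtain ⟨H, hHm, hH, hHt, hHf⟩ := exists_selection d h (2 * α)
  obtain ⟨p, hp, hS⟩ := exists_totalScore_ge_of_isMeanEstimator (lam := lam) (h := h) hα hα8
    hlam0 (by rw [e5]; exact hhalf) A hA hHm hH hHt hHf (by
      rw [e4, e5]
      calc _ ≤ Real.exp (-2) := Real.exp_le_exp.2 htail
        _ ≤ 1 / 4 := by
          rw [Real.exp_neg, inv_le_comm₀ (Real.exp_pos 2) (by norm_num),
            show (2 : ℝ) = 1 + 1 by norm_num, Real.exp_add]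
          nlinarith [Real.exp_one_gt_d9])
  set T := Real.sqrt (32 * h) * Real.sqrt (Real.log (1 / ξ)) with hT
  have hh0' : (0 : ℝ) < h := by exact_mod_cast hh0
  have hT0 : 0 < T := mul_pos (Real.sqrt_pos.2 (by positivity)) (Real.sqrt_pos.2 (by linarith))
  have hT2 : T ^ 2 = 32 * h * Real.log (1 / ξ) := by
    rw [hT, mul_pow, Real.sq_sqrt (by positivity), Real.sq_sqrt (by linarith)]
  set M := (1 / 512000) ^ 2 * L / α ^ 2 with hM
  have hM0 : 0 < M := by positivity
  have hlow : 1 / 1000 * L / α * (h / 8) ≤ totalScore A H p := by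
    refine le_trans ?_ hS
    rw [e5]
    apply mul_le_mul_of_nonneg_left _ hlam0.le
    linarith
  -- A smaller expected count would push the upper bound on the total score below the lower bound.
  have hcount : M < ∑ z, sampleWeight p z * ∫ θ, (tracedCount p T z (H θ) : ℝ) ∂(A z) := by
    by_contra hcon
    have hup := totalScore_le hp hd1 hnd hh0 A hHm hH hT0 hM0 (not_lt.1 hcon)
    have hsep := score_bounds_separated (T := T) hd6 hh0 hα hα8 hL1 hX0.le ha hK hXh hM hT
    linarith
  exact ⟨⌈(1 / 512000) ^ 2 / 2 * (L / α ^ 2)⌉₊, Nat.le_ceil _,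
    isTraceable_of_tracedCount hp A hHm hH hh0 hξ hT0 hT2
      ((ceil_recall_le hα hα8 hlog).trans hcount.le)⟩
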